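/- Let $p\le 2$ with conjugate exponent $p'=p/(p-1)$, and let $1<p'\le q<\infty$ (so $1<p\le 2$). Let $(\lambda_k)_{k\in\mathbb N}$ be complex numbers with $\operatorname{Re}\lambda_k<0$ for all $k$, let $A$ be the diagonal operator $(Ax)_k=\lambda_kx_k$ on $\ell^q$ with domain $D(A)=\{x\in\ell^q:(\lambda_kx_k)\in\ell^q\}$, and let $T(t)=\operatorname{diag}(e^{\lambda_kt})$, $t\ge 0$, be the $C_0$-semigroup it generates. Let $D(A^*)'$ be the completion of $\ell^q$ in the norm $\|(1-A)^{-1}x\|_{\ell^q}$, that is, the space of sequences $(x_k)$ with $(x_k/(1-\lambda_k))\in\ell^q$; $T(t)$ extends to $D(A^*)'$, and for $\lambda\in\mathbb C_+=\{\operatorname{Re}\lambda>0\}$ the resolvent $(\lambda-A)^{-1}$ extends to a bounded operator $D(A^*)'\to\ell^q$. Let $B:\mathbb C\to D(A^*)'$ be bounded and linear, with $B1=(b_k)$, and put $\mu=\sum_k|b_k|^q\delta_{-\lambda_k}$. Then the following statements are equivalent. 1. $B$ is an admissible control operator with respect to $L^p(0,\infty)$: there is a constant $m_0>0$ such that for every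 $u\in L^p(0,\infty)$ the integral $\int_0^\infty T(t)Bu(t)\,dt:=\lim_{\tau\to\infty}\int_0^\tau T(t)Bu(t)\,dt$ (integrals and limit taken in $D(A^*)'$) exists, lies in $\ell^q$, and satisfies $$\Big\|\int_0^\infty T(t)Bu(t)\,dt\Big\|_{\ell^q}\le m_0\|u\|_{L^p(0,\infty)}.$$ 2. There is a constant $\kappa>0$ such that $\mu(Q_I)\le\kappa|I|^{q/p'}$ for all intervals $I\subset i\mathbb R$, where $|I|$ is the length of $I$ and $Q_I=\{x+iy: iy\in I,\ 0<x<|I|\}$. 3. There is a constant $\kappa>0$ such that $\|(\lambda-A)^{-1}B\|_{\ell^q}\le\kappa\,|\operatorname{Re}\lambda|^{-1/p}$ for all $\lambda\in\mathbb C_+$. -/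

import Mathlib

open MeasureTheory Filter Topology Set
open scoped ENNReal NNReal

noncomputable section

namespace DiagSys

/-- The sequence space `ℓ^q` of complex sequences indexed by `ℕ`. -/
abbrev Seq (q : ℝ≥0∞) : Type := lp (fun _ : ℕ => ℂ) q

/-! ### Multiplication operators on `ℓ^q` -/

lemma memlp_mul {q : ℝ≥0∞} {m x : ℕ → ℂ} (hm : ∃ C : ℝ, ∀ k, ‖m k‖ ≤ C)
    (hx : Memℓp x q) : Memℓp (fun k => m k * x k) q := by
  obtain ⟨C, hC⟩ := hm
  have h0 : 0 ≤ C := (norm_nonneg _).trans (hC 0)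
  refine (hx.const_mul (C : ℂ)).mono' fun k => ?_
  simp only [norm_mul, Complex.norm_real, Real.norm_eq_abs, abs_of_nonneg h0]
  exact mul_le_mul_of_nonneg_right (hC k) (norm_nonneg _)

/-- Coordinatewise multiplication by a bounded sequence, as a bounded operator on `ℓ^q`. -/
def mulCLM (q : ℝ≥0∞) [Fact (1 ≤ q)] (m : ℕ → ℂ) (hm : ∃ C : ℝ, ∀ k, ‖m k‖ ≤ C) :
    Seq q →L[ℂ] Seq q :=
  LinearMap.mkContinuous
    { toFun := fun x => ⟨fun k => m k * x k, memlp_mul hm (lp.memℓp x)⟩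
      map_add' := fun x y => by ext k; exact mul_add _ _ _
      map_smul' := fun c x => by ext k; simp [mul_left_comm] }
    hm.choose fun x => by
      have h0 : 0 ≤ hm.choose := (norm_nonneg _).trans (hm.choose_spec 0)
      have hq : q ≠ 0 := (zero_lt_one.trans_le (Fact.out : 1 ≤ q)).ne'
      have h1 : ‖(hm.choose : ℂ) • x‖ = hm.choose * ‖x‖ := by
        rw [norm_smul, Complex.norm_real, Real.norm_eq_abs, abs_of_nonneg h0]
      rw [← h1]
      refine lp.norm_mono hq fun k => ?_
      change ‖m k * x k‖ ≤ ‖(hm.choose : ℂ) * x k‖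
      rw [norm_mul, norm_mul, Complex.norm_real, Real.norm_eq_abs, abs_of_nonneg h0]
      exact mul_le_mul_of_nonneg_right (hm.choose_spec k) (norm_nonneg _)

@[simp] lemma mulCLM_apply (q : ℝ≥0∞) [Fact (1 ≤ q)] (m : ℕ → ℂ)
    (hm : ∃ C : ℝ, ∀ k, ‖m k‖ ≤ C) (x : Seq q) (k : ℕ) :
    mulCLM q m hm x k = m k * x k := rfl

/-! ### The diagonal operator `A` and its semigroup on `ℓ^q` -/

/-- The diagonal operator `A` with eigenvalues `lam`: `(A x)_k = lam_k x_k`, on its maximal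
domain `D(A) = {x ∈ ℓ^q : (lam_k x_k) ∈ ℓ^q}`. -/
def diagOp (q : ℝ≥0∞) [Fact (1 ≤ q)] (lam : ℕ → ℂ) : Seq q →ₗ.[ℂ] Seq q where
  domain :=
    { carrier := {x | Memℓp (fun k => lam k * x k) q}
      zero_mem' := by
        have h : (fun k => lam k * (0 : Seq q) k) = (0 : ℕ → ℂ) := by ext k; simp
        simpa only [mem_ofPred_eq, h] using (zero_memℓp : Memℓp (0 : ℕ → ℂ) q)
      add_mem' := fun {x y} hx hy => by
        have h : (fun k => lam k * (x + y : Seq q) k)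
            = (fun k => lam k * x k) + fun k => lam k * y k := by
          ext k; simp [mul_add]
        simpa only [mem_ofPred_eq, h] using Memℓp.add hx hy
      smul_mem' := fun c x hx => by
        have h : (fun k => lam k * (c • x : Seq q) k) = fun k => c * (lam k * x k) := by
          ext k; simp [mul_left_comm]
        simpa only [mem_ofPred_eq, h] using Memℓp.const_mul hx c }
  toFun :=
    { toFun := fun x => ⟨fun k => lam k * (x : Seq q) k, x.2⟩
      map_add' := fun x y => by ext k; exact mul_add _ _ _
      map_smul' := fun c x => by ext k; simp [mul_left_comm] }

section

variable {lam : ℕ → ℂ}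

lemma exp_bound (hlam : ∀ k, (lam k).re < 0) (t : ℝ≥0) :
    ∃ C : ℝ, ∀ k, ‖Complex.exp (lam k * (t : ℝ))‖ ≤ C := by
  refine ⟨1, fun k => ?_⟩
  rw [Complex.norm_exp, Complex.re_mul_ofReal]
  exact Real.exp_le_one_iff.2 (mul_nonpos_of_nonpos_of_nonneg (hlam k).le t.2)

lemma sub_ne (hlam : ∀ k, (lam k).re < 0) {z : ℂ} (hz : 0 < z.re) (k : ℕ) :
    z - lam k ≠ 0 := by
  intro h
  have := congrArg Complex.re h
  simp only [Complex.sub_re, Complex.zero_re] at this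
  linarith [hlam k]

lemma le_norm_sub (hlam : ∀ k, (lam k).re < 0) (z : ℂ) (k : ℕ) :
    z.re ≤ ‖z - lam k‖ := by
  refine le_trans ?_ (Complex.re_le_norm _)
  simp only [Complex.sub_re]
  linarith [hlam k]

lemma resolvent_bound (hlam : ∀ k, (lam k).re < 0) {z : ℂ} (hz : 0 < z.re) :
    ∃ C : ℝ, ∀ k, ‖(z - lam k)⁻¹‖ ≤ C := by
  refine ⟨z.re⁻¹, fun k => ?_⟩
  rw [norm_inv]
  exact inv_anti₀ hz (le_norm_sub hlam z k)

lemma ratio_bound (hlam : ∀ k, (lam k).re < 0) {z : ℂ} (hz : 0 < z.re) :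
    ∃ C : ℝ, ∀ k, ‖(1 - lam k) / (z - lam k)‖ ≤ C := by
  refine ⟨1 + ‖1 - z‖ * z.re⁻¹, fun k => ?_⟩
  have h : (1 - lam k) / (z - lam k) = 1 + (1 - z) * (z - lam k)⁻¹ := by
    have := sub_ne hlam hz k
    field_simp
    ring
  rw [h]
  refine (norm_add_le _ _).trans ?_
  rw [norm_one, norm_mul, norm_inv]
  gcongr
  exact le_norm_sub hlam z k

/-- The `C₀`-semigroup `T(t)` on `ℓ^q` generated by the diagonal operator `A`:
`(T(t) x)_k = exp(lam_k t) x_k`. -/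
def semigroup (q : ℝ≥0∞) [Fact (1 ≤ q)] (hlam : ∀ k, (lam k).re < 0) (t : ℝ≥0) :
    Seq q →L[ℂ] Seq q :=
  mulCLM q (fun k => Complex.exp (lam k * (t : ℝ))) (exp_bound hlam t)

/-- The resolvent `(z - A)⁻¹` on `ℓ^q`, for `Re z > 0`. -/
def resolvent (q : ℝ≥0∞) [Fact (1 ≤ q)] (hlam : ∀ k, (lam k).re < 0) (z : ℂ) (hz : 0 < z.re) :
    Seq q →L[ℂ] Seq q :=
  mulCLM q (fun k => (z - lam k)⁻¹) (resolvent_bound hlam hz)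

/-- `resolvent` is the two-sided inverse of `z - A : D(A) → ℓ^q`. -/
lemma resolvent_spec (q : ℝ≥0∞) [Fact (1 ≤ q)] (hlam : ∀ k, (lam k).re < 0) (z : ℂ)
    (hz : 0 < z.re) :
    (∀ x : (diagOp q lam).domain,
      resolvent q hlam z hz (z • (x : Seq q) - diagOp q lam x) = x) ∧
    ∀ y : Seq q, ∃ x : (diagOp q lam).domain,
      (x : Seq q) = resolvent q hlam z hz y ∧ z • (x : Seq q) - diagOp q lam x = y := by
  constructor
  · intro x
    ext k
    have := sub_ne hlam hz k
    change (z - lam k)⁻¹ * (z * (x : Seq q) k - lam k * (x : Seq q) k) = (x : Seq q) k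
    field_simp
  · intro y
    refine ⟨⟨resolvent q hlam z hz y, ?_⟩, rfl, ?_⟩
    · change Memℓp (fun k => lam k * ((z - lam k)⁻¹ * y k)) q
      have h : (fun k => lam k * ((z - lam k)⁻¹ * y k))
          = (fun k => z * ((z - lam k)⁻¹ * y k)) - y := by
        ext k
        have := sub_ne hlam hz k
        simp only [Pi.sub_apply]
        field_simp
        ring
      rw [h]
      exact ((memlp_mul (resolvent_bound hlam hz) (lp.memℓp y)).const_mul z).sub (lp.memℓp y)
    · ext k
      have := sub_ne hlam hz k
      change z * ((z - lam k)⁻¹ * y k) - lam k * ((z - lam k)⁻¹ * y k) = y k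
      field_simp

/-- Dominated convergence in `ℓ^q`, `q < ∞`. -/
lemma tendsto_of_dominated {q : ℝ≥0∞} [Fact (1 ≤ q)] (hq : q ≠ ∞) {ι : Type*} {l : Filter ι}
    {F : ι → Seq q} {f : Seq q} {g : Seq q} (hlim : ∀ k, Tendsto (fun i => F i k) l (𝓝 (f k)))
    (hb : ∀ᶠ i in l, ∀ k, ‖F i k - f k‖ ≤ ‖g k‖) : Tendsto F l (𝓝 f) := by
  have hq0 : 0 < q.toReal :=
    ENNReal.toReal_pos (zero_lt_one.trans_le (Fact.out : 1 ≤ q)).ne' hq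
  rw [tendsto_iff_norm_sub_tendsto_zero]
  have h := tendsto_tsum_of_dominated_convergence (𝓕 := l)
    (f := fun i k => ‖F i k - f k‖ ^ q.toReal) (g := fun _ => (0 : ℝ))
    (bound := fun k => ‖g k‖ ^ q.toReal) ((lp.memℓp g).summable hq0)
    (fun k => by
      have := (tendsto_iff_norm_sub_tendsto_zero.1 (hlim k)).rpow_const
        (p := q.toReal) (Or.inr hq0.le)
      rwa [Real.zero_rpow hq0.ne'] at this)
    (hb.mono fun i hi k => by
      rw [Real.norm_of_nonneg (by positivity)]
      exact Real.rpow_le_rpow (norm_nonneg _) (hi k) hq0.le)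
  have h2 := h.rpow_const (p := 1 / q.toReal) (Or.inr (by positivity))
  simp only [tsum_zero] at h2
  rw [Real.zero_rpow (by positivity)] at h2
  refine h2.congr fun i => ?_
  rw [lp.norm_eq_tsum_rpow hq0]
  rfl

lemma norm_exp_sub_one_le {w : ℂ} (hw : w.re ≤ 0) : ‖Complex.exp w - 1‖ ≤ ‖w‖ := by
  have hc : Convex ℝ {z : ℂ | z.re ≤ 0} := convex_halfSpace_re_le 0
  have h := hc.norm_image_sub_le_of_norm_deriv_le (𝕜 := ℂ) (f := Complex.exp) (C := 1)
    (x := 0) (y := w) (fun z _ => Complex.differentiable_exp z)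
    (fun z hz => by
      rw [Complex.deriv_exp, Complex.norm_exp]
      exact Real.exp_le_one_iff.2 hz) (by simp) hw
  simpa using h

/-- `T` is a strongly continuous semigroup. -/
lemma semigroup_isC0 (q : ℝ≥0∞) [Fact (1 ≤ q)] (hq : q ≠ ∞) (hlam : ∀ k, (lam k).re < 0) :
    semigroup q hlam 0 = ContinuousLinearMap.id ℂ _ ∧
    (∀ s t, semigroup q hlam (s + t) = (semigroup q hlam s).comp (semigroup q hlam t)) ∧
    ∀ x, Tendsto (fun t => semigroup q hlam t x) (𝓝 0) (𝓝 x) := by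
  refine ⟨?_, ?_, ?_⟩
  · ext x k
    simp [semigroup]
  · intro s t
    ext x k
    simp [semigroup, mul_add, Complex.exp_add, mul_assoc]
  · intro x
    refine tendsto_of_dominated hq (g := (2 : ℂ) • x) (fun k => ?_)
      (Eventually.of_forall fun t k => ?_)
    · have h : Continuous fun t : ℝ≥0 => Complex.exp (lam k * ((t : ℝ) : ℂ)) * x k := by
        fun_prop
      exact h.tendsto' 0 _ (by simp)
    · change ‖Complex.exp (lam k * ((t : ℝ) : ℂ)) * x k - x k‖ ≤ ‖2 * x k‖
      have h1 : ‖Complex.exp (lam k * ((t : ℝ) : ℂ))‖ ≤ 1 := by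
        rw [Complex.norm_exp, Complex.re_mul_ofReal]
        exact Real.exp_le_one_iff.2 (mul_nonpos_of_nonpos_of_nonneg (hlam k).le t.2)
      refine (norm_sub_le _ _).trans ?_
      rw [norm_mul, norm_mul, Complex.norm_ofNat]
      nlinarith [norm_nonneg (x k)]

/-- The generator of the semigroup `T` is exactly `A` (with the domain of `A`). -/
lemma semigroup_generator (q : ℝ≥0∞) [Fact (1 ≤ q)] (hq : q ≠ ∞) (hlam : ∀ k, (lam k).re < 0)
    (x y : Seq q) :
    Tendsto (fun t : ℝ≥0 => (((t : ℝ) : ℂ))⁻¹ • (semigroup q hlam t x - x)) (𝓝[>] 0) (𝓝 y) ↔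
      ∃ hx : x ∈ (diagOp q lam).domain, diagOp q lam ⟨x, hx⟩ = y := by
  have hco : ∀ k, Tendsto (fun t : ℝ≥0 => (((t : ℝ) : ℂ))⁻¹ *
      (Complex.exp (lam k * ((t : ℝ) : ℂ)) * x k - x k)) (𝓝[>] 0) (𝓝 (lam k * x k)) := by
    intro k
    have hd : HasDerivAt (fun t : ℝ => Complex.exp (lam k * (t : ℂ)) * x k) (lam k * x k) 0 := by
      have h1 : HasDerivAt (fun z : ℂ => Complex.exp (lam k * z) * x k)
          (Complex.exp (lam k * ((0 : ℝ) : ℂ)) * (lam k * 1) * x k) ((0 : ℝ) : ℂ) :=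
        (((hasDerivAt_id _).const_mul (lam k)).cexp).mul_const (x k)
      have h2 := h1.comp_ofReal
      simpa using h2
    have h3 := hasDerivAt_iff_tendsto_slope.1 hd
    have h4 : Tendsto (fun t : ℝ≥0 => (t : ℝ)) (𝓝[>] 0) (𝓝[≠] 0) := by
      refine tendsto_nhdsWithin_iff.2 ⟨?_, ?_⟩
      · exact (NNReal.continuous_coe.tendsto' 0 0 rfl).mono_left nhdsWithin_le_nhds
      · filter_upwards [self_mem_nhdsWithin] with t ht
        exact (NNReal.coe_pos.2 ht).ne'
    refine (h3.comp h4).congr fun t => ?_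
    simp [slope_def_module, Complex.real_smul]
  constructor
  · intro h
    have hy : ∀ k, lam k * x k = y k := fun k => by
      refine tendsto_nhds_unique (hco k) ?_
      have := ((lp.evalCLM ℂ (fun _ : ℕ => ℂ) q k).continuous.tendsto y).comp h
      exact this
    have hm : (fun k => lam k * x k) = (y : ℕ → ℂ) := funext hy
    refine ⟨?_, ?_⟩
    · change Memℓp (fun k => lam k * x k) q
      rw [hm]
      exact lp.memℓp y
    · ext k
      exact hy k
  · rintro ⟨hx, rfl⟩
    refine tendsto_of_dominated hq (g := (2 : ℂ) • diagOp q lam ⟨x, hx⟩) (fun k => hco k) ?_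
    filter_upwards [self_mem_nhdsWithin] with t ht k
    have ht' : (0 : ℝ) < t := NNReal.coe_pos.2 ht
    change ‖(((t : ℝ) : ℂ))⁻¹ * (Complex.exp (lam k * ((t : ℝ) : ℂ)) * x k - x k)
      - lam k * x k‖ ≤ ‖2 * (lam k * x k)‖
    have h1 : ‖Complex.exp (lam k * ((t : ℝ) : ℂ)) - 1‖ ≤ ‖lam k * ((t : ℝ) : ℂ)‖ := by
      refine norm_exp_sub_one_le ?_
      rw [Complex.re_mul_ofReal]
      exact mul_nonpos_of_nonpos_of_nonneg (hlam k).le t.2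
    rw [norm_mul, Complex.norm_real, Real.norm_of_nonneg ht'.le] at h1
    have h2 : ‖(((t : ℝ) : ℂ))⁻¹ * (Complex.exp (lam k * ((t : ℝ) : ℂ)) * x k - x k)‖
        ≤ ‖lam k * x k‖ := by
      have e : Complex.exp (lam k * ((t : ℝ) : ℂ)) * x k - x k
          = (Complex.exp (lam k * ((t : ℝ) : ℂ)) - 1) * x k := by ring
      rw [e, norm_mul, norm_mul, norm_inv, Complex.norm_real, Real.norm_of_nonneg ht'.le,
        norm_mul, ← mul_assoc]
      refine mul_le_mul_of_nonneg_right ?_ (norm_nonneg _)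
      rw [inv_mul_le_iff₀ ht']
      linarith
    refine (norm_sub_le _ _).trans ?_
    rw [norm_mul 2, Complex.norm_ofNat]
    linarith

/-! ### The extrapolation space `D(A*)'` -/

/-- The sequences `b` with `(b_k / (1 - lam_k)) ∈ ℓ^q`. -/
def extrapSubmodule (q : ℝ≥0∞) [Fact (1 ≤ q)] (lam : ℕ → ℂ) : Submodule ℂ (ℕ → ℂ) where
  carrier := {b | Memℓp (fun k => b k / (1 - lam k)) q}
  zero_mem' := by
    have h : (fun k => (0 : ℕ → ℂ) k / (1 - lam k)) = (0 : ℕ → ℂ) := by ext k; simp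
    simpa only [mem_ofPred_eq, h] using (zero_memℓp : Memℓp (0 : ℕ → ℂ) q)
  add_mem' := fun {x y} hx hy => by
    have h : (fun k => (x + y) k / (1 - lam k))
        = (fun k => x k / (1 - lam k)) + fun k => y k / (1 - lam k) := by
      ext k; simp [add_div]
    simpa only [mem_ofPred_eq, h] using Memℓp.add hx hy
  smul_mem' := fun c x hx => by
    have h : (fun k => (c • x) k / (1 - lam k)) = fun k => c * (x k / (1 - lam k)) := by
      ext k; simp [mul_div_assoc]
    simpa only [mem_ofPred_eq, h] using Memℓp.const_mul hx c

/-- The space `D(A*)'`, i.e. the completion of `ℓ^q` for the norm `‖(1 - A)⁻¹ x‖`, realised as the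
space of all sequences `b` with `‖(b_k / (1 - lam_k))‖_{ℓ^q} < ∞`. That this is a completion is
proved below: `ℓ^q` is embedded by `ExtrapSpace.incl` with the right norm (`norm_incl`) and dense
range (`denseRange_incl`), and the space is complete. -/
def ExtrapSpace (q : ℝ≥0∞) [Fact (1 ≤ q)] {lam : ℕ → ℂ} (_hlam : ∀ k, (lam k).re < 0) : Type :=
  extrapSubmodule q lam

namespace ExtrapSpace

variable {q : ℝ≥0∞} [Fact (1 ≤ q)] {hlam : ∀ k, (lam k).re < 0}

instance : AddCommGroup (ExtrapSpace q hlam) :=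
  inferInstanceAs (AddCommGroup (extrapSubmodule q lam))

instance : Module ℂ (ExtrapSpace q hlam) :=
  inferInstanceAs (Module ℂ (extrapSubmodule q lam))

/-- The `k`-th coordinate `b_k` of an element of `D(A*)'`. -/
def coord (b : ExtrapSpace q hlam) (k : ℕ) : ℂ := b.1 k

lemma ext_coord {b c : ExtrapSpace q hlam} (h : ∀ k, b.coord k = c.coord k) : b = c :=
  Subtype.ext (funext h)

/-- The bijection `b ↦ (b_k / (1 - lam_k))` of `D(A*)'` onto `ℓ^q`, extending `(1 - A)⁻¹`. -/
def toSeq : ExtrapSpace q hlam ≃ₗ[ℂ] Seq q where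
  toFun b := ⟨fun k => b.coord k / (1 - lam k), b.2⟩
  invFun x := ⟨fun k => (1 - lam k) * x k, by
    change Memℓp (fun k => (1 - lam k) * x k / (1 - lam k)) q
    have h : (fun k => (1 - lam k) * x k / (1 - lam k)) = (x : ℕ → ℂ) := by
      ext k
      exact mul_div_cancel_left₀ _ (sub_ne hlam (z := 1) (by simp) k)
    rw [h]
    exact lp.memℓp x⟩
  map_add' x y := by
    ext k
    exact add_div _ _ _
  map_smul' c x := by
    ext k
    exact mul_div_assoc _ _ _
  left_inv b := ext_coord fun k => by
    change (1 - lam k) * (b.coord k / (1 - lam k)) = b.coord k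
    exact mul_div_cancel₀ _ (sub_ne hlam (z := 1) (by simp) k)
  right_inv x := by
    ext k
    change (1 - lam k) * x k / (1 - lam k) = x k
    exact mul_div_cancel_left₀ _ (sub_ne hlam (z := 1) (by simp) k)

instance : NormedAddCommGroup (ExtrapSpace q hlam) :=
  NormedAddCommGroup.induced _ _ (toSeq (q := q) (hlam := hlam)).toLinearMap toSeq.injective

instance : NormedSpace ℂ (ExtrapSpace q hlam) :=
  NormedSpace.induced ℂ (ExtrapSpace q hlam) (Seq q) toSeq.toLinearMap

variable (q hlam) in
/-- `D(A*)'` is isometric to `ℓ^q` through (the extension of) `(1 - A)⁻¹`. -/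
def iso : ExtrapSpace q hlam ≃ₗᵢ[ℂ] Seq q where
  toLinearEquiv := toSeq
  norm_map' _ := rfl

instance : CompleteSpace (ExtrapSpace q hlam) :=
  (iso q hlam).toIsometryEquiv.completeSpace

variable (q hlam) in
/-- The continuous embedding of `ℓ^q` into `D(A*)'`, the identity on sequences. -/
def incl : Seq q →L[ℂ] ExtrapSpace q hlam :=
  ((iso q hlam).symm : Seq q →L[ℂ] ExtrapSpace q hlam).comp (resolvent q hlam 1 (by simp))

@[simp] lemma coord_incl (x : Seq q) (k : ℕ) : (incl q hlam x).coord k = x k := by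
  change (1 - lam k) * ((1 - lam k)⁻¹ * x k) = x k
  exact mul_inv_cancel_left₀ (sub_ne hlam (z := 1) (by simp) k) _

lemma norm_incl (x : Seq q) : ‖incl q hlam x‖ = ‖resolvent q hlam 1 (by simp) x‖ :=
  (iso q hlam).symm.norm_map _

lemma denseRange_incl (hq : q ≠ ∞) : DenseRange (incl q hlam) := by
  have h : DenseRange (resolvent q hlam 1 (by simp)) := by
    intro x
    have hs := lp.hasSum_single hq x
    refine mem_closure_of_tendsto hs (Eventually.of_forall fun s => ?_)
    refine ⟨∑ k ∈ s, (1 - lam k) • lp.single q k (x k), ?_⟩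
    rw [map_sum]
    refine Finset.sum_congr rfl fun k _ => ?_
    ext j
    rw [map_smul]
    change (1 - lam k) * ((1 - lam j)⁻¹ * _) = _
    have := sub_ne hlam (z := 1) (by simp) k
    by_cases hj : j = k
    · subst hj
      simp only [lp.single_apply_self]
      field_simp
    · rw [lp.single_apply_ne _ _ _ hj]
      simp
  exact (iso q hlam).symm.surjective.denseRange.comp h (iso q hlam).symm.continuous

variable (q hlam) in
/-- The extension of the semigroup operator `T(t)` to `D(A*)'`. -/
def semigroupExt (t : ℝ≥0) : ExtrapSpace q hlam →L[ℂ] ExtrapSpace q hlam :=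
  ((iso q hlam).symm : Seq q →L[ℂ] ExtrapSpace q hlam).comp
    ((semigroup q hlam t).comp (iso q hlam : ExtrapSpace q hlam →L[ℂ] Seq q))

@[simp] lemma coord_semigroupExt (t : ℝ≥0) (b : ExtrapSpace q hlam) (k : ℕ) :
    (semigroupExt q hlam t b).coord k = Complex.exp (lam k * (t : ℝ)) * b.coord k := by
  change (1 - lam k) * (Complex.exp (lam k * (t : ℝ)) * (b.coord k / (1 - lam k))) = _
  have := sub_ne hlam (z := 1) (by simp) k
  field_simp

lemma semigroupExt_incl (t : ℝ≥0) (x : Seq q) :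
    semigroupExt q hlam t (incl q hlam x) = incl q hlam (semigroup q hlam t x) :=
  ext_coord fun k => by simp [semigroup]

variable (q hlam) in
/-- The extension of the resolvent `(z - A)⁻¹`, `Re z > 0`, to a bounded operator from `D(A*)'`
to `ℓ^q`. -/
def resolventExt (z : ℂ) (hz : 0 < z.re) : ExtrapSpace q hlam →L[ℂ] Seq q :=
  (mulCLM q (fun k => (1 - lam k) / (z - lam k)) (ratio_bound hlam hz)).comp
    (iso q hlam : ExtrapSpace q hlam →L[ℂ] Seq q)

@[simp] lemma resolventExt_apply (z : ℂ) (hz : 0 < z.re) (b : ExtrapSpace q hlam) (k : ℕ) :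
    resolventExt q hlam z hz b k = b.coord k / (z - lam k) := by
  change (1 - lam k) / (z - lam k) * (b.coord k / (1 - lam k)) = _
  have := sub_ne hlam (z := 1) (by simp) k
  have := sub_ne hlam hz k
  field_simp

lemma resolventExt_incl (z : ℂ) (hz : 0 < z.re) (x : Seq q) :
    resolventExt q hlam z hz (incl q hlam x) = resolvent q hlam z hz x := by
  ext k
  simp [resolvent, div_eq_inv_mul]

end ExtrapSpace

/-! ### Admissibility -/

/-- `y = ∫₀^∞ f(t) dt` for `f : (0, ∞) → E`: `f` is Bochner integrable on bounded intervals and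
the integrals over `(0, τ]` converge to `y` as `τ → ∞`. -/
def HasIntegralToInfinity {E : Type*} [NormedAddCommGroup E] [NormedSpace ℝ E]
    (f : ℝ → E) (y : E) : Prop :=
  (∀ τ : ℝ, IntegrableOn f (Ioc 0 τ)) ∧
    Tendsto (fun τ : ℝ => ∫ t in Ioc 0 τ, f t) atTop (𝓝 y)

/-- `L^p(0, ∞)`, complex valued. -/
abbrev InputSpace (p : ℝ≥0∞) : Type := Lp ℂ p (volume.restrict (Ioi (0 : ℝ)))

/-- Admissibility of the control operator `B : ℂ → D(A*)'` with respect to `L^p(0, ∞)`: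
there is `m₀ > 0` such that for every `u ∈ L^p(0, ∞)` the integral `∫₀^∞ T(t) B u(t) dt`, formed
in `D(A*)'`, lies in `ℓ^q` and has `ℓ^q`-norm at most `m₀ ‖u‖_p`. -/
def IsAdmissible (p q : ℝ≥0∞) [Fact (1 ≤ q)] {hlam : ∀ k, (lam k).re < 0}
    (B : ℂ →L[ℂ] ExtrapSpace q hlam) : Prop :=
  ∃ m₀ : ℝ, 0 < m₀ ∧ ∀ u : InputSpace p, ∃ x : Seq q,
    HasIntegralToInfinity (fun t : ℝ => ExtrapSpace.semigroupExt q hlam t.toNNReal (B (u t)))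
      (ExtrapSpace.incl q hlam x) ∧
    ‖x‖ ≤ m₀ * ‖u‖

end

/-! ### Carleson squares -/

/-- The measure `μ = ∑_k |b_k|^q δ_{-lam_k}` on `ℂ`. -/
def pointMeasure (q : ℝ≥0∞) (lam b : ℕ → ℂ) : Measure ℂ :=
  Measure.sum fun k => ENNReal.ofReal (‖b k‖ ^ q.toReal) • Measure.dirac (-lam k)

/-- The Carleson square `Q_I = {x + iy : iy ∈ iI, 0 < x < |I|}` over the interval `iI ⊂ iℝ`;
an interval of `iℝ` is given by the corresponding interval `I` of `ℝ`. -/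
def carlesonSquare (I : Set ℝ) : Set ℂ :=
  {z | z.im ∈ I ∧ 0 < z.re ∧ ENNReal.ofReal z.re < volume I}

end DiagSys

end

namespace DiagSys

/-! ### Poisson integrals and Carleson families -/

/-! Everything is diagonal: the `k`-th coordinate of `∫ T(t) B u(t) dt` is `b_k û(-λ_k)`, where `û`
is the Laplace transform of `u`. Admissibility therefore says that `u ↦ û` is bounded from
`L^p(0,∞)` to `L^q(μ)`, and the theorem becomes a Laplace–Carleson embedding with exponent `s = q/p'
≥ 1`.

Two implications come from testing. The input `e^{-zt}` has Laplace transform `1/(z - λ_k)` at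
`-λ_k` and `L^p` norm at most `(Re z)^{-1/p}`, so admissibility yields the resolvent bound
(`norm_resolventExt_comp_le_of_isAdmissible`). Conversely, for an interval of length `r`, take `z`
with real part `r` and imaginary part opposite to a point of the interval. Then `|z - λ_k| ≤ 3r` for
every `-λ_k` in the square, and the resolvent bound at `z` controls the mass of the square
(`carlesonSquare_le_of_norm_resolventExt_comp_le`).

The substance is the embedding `exists_lintegral_laplace_rpow_le`. A Vitali covering argument shows
that the Poisson integral is of weak type `(1, s)` for an `s`-Carleson family
(`measure_lt_poissonInt_le`); interpolation with the trivial `L^∞` bound gives `L² → L^{2s}`. Since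
`|û|` is dominated by the Poisson integral of its boundary values, whose `L²` norm Plancherel
computes, the case `p = 2` follows. A second interpolation, against `|û| ≤ ‖u‖₁`, reaches `1 < p <
2` with target exponent `s p' = q`.

Applied to the tails `u 1_{(τ,∞)}`, the same embedding shows that the integrals over `(0, τ]`
converge. -/

/-- The (unnormalised) Poisson integral at `z`, `0 < Re z`, of a function on the imaginary axis. -/
noncomputable def poissonInt (g : ℝ → ℝ≥0∞) (z : ℂ) : ℝ≥0∞ :=
  ∫⁻ t, ENNReal.ofReal (z.re / (z.re ^ 2 + (z.im - t) ^ 2)) * g t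

/-- The family of points `ζ` with masses given by `ν` is `s`-Carleson with constant `K`. -/
def IsCarlesonFamily {ι : Type*} [MeasurableSpace ι] (ν : Measure ι) (ζ : ι → ℂ) (K : ℝ≥0∞)
    (s : ℝ) : Prop :=
  ∀ y r : ℝ, 0 < r → ν {k | |(ζ k).im - y| ≤ r ∧ (ζ k).re ≤ r} ≤ K * ENNReal.ofReal r ^ s

/-- Dyadic decomposition of the kernel. For the least `j` with `|y - t| ≤ 2^j x`, either `j = 0` and
the kernel is at most `1/x`, or `|y - t| > 2^{j-1} x` and it is at most `4 · 4^{-j} / x`. That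
single term of the series already suffices. -/
lemma poisson_le_tsum {x : ℝ} (hx : 0 < x) (y t : ℝ) :
    ENNReal.ofReal (x / (x ^ 2 + (y - t) ^ 2)) ≤
      ∑' j : ℕ, ENNReal.ofReal (4 * (1 / 4) ^ j / x) *
        (Metric.closedBall y (2 ^ j * x)).indicator 1 t := by
  have hex : ∃ j : ℕ, |y - t| ≤ 2 ^ j * x := by
    obtain ⟨j, hj⟩ := pow_unbounded_of_one_lt (|y - t| / x) (one_lt_two)
    exact ⟨j, by rw [div_lt_iff₀ hx] at hj; exact hj.le⟩
  classical
  set j := Nat.find hex with hj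
  have hmem : t ∈ Metric.closedBall y (2 ^ j * x) := by
    rw [Metric.mem_closedBall, dist_comm, Real.dist_eq]
    exact Nat.find_spec hex
  refine le_trans ?_ (ENNReal.le_tsum j)
  rw [indicator_of_mem hmem, Pi.one_apply, mul_one]
  refine ENNReal.ofReal_le_ofReal ?_
  rcases Nat.eq_zero_or_pos j with h0 | h0
  · rw [h0, div_le_div_iff₀ (by positivity) hx]
    nlinarith [sq_nonneg (y - t), sq_nonneg x]
  · obtain ⟨i, hi⟩ := Nat.exists_eq_succ_of_ne_zero h0.ne'
    have hlt : 2 ^ i * x < |y - t| := not_le.1 (Nat.find_min hex (by omega))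
    have h2 : (2 ^ i * x) ^ 2 ≤ (y - t) ^ 2 := by
      rw [← sq_abs (y - t)]
      exact pow_le_pow_left₀ (by positivity) hlt.le 2
    have h4 : (4 : ℝ) ^ i = (2 ^ i) ^ 2 := by rw [← pow_mul, mul_comm, pow_mul]; norm_num
    have e : 4 * (1 / 4 : ℝ) ^ j / x = 1 / (4 ^ i * x) := by
      rw [hi, pow_succ, one_div_pow]; field_simp
    rw [e, div_le_div_iff₀ (by positivity) (by positivity), h4]
    nlinarith [sq_nonneg x]

/-- A Poisson integral is controlled by the averages over the intervals centred at `Im z` of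
radius at least `Re z`. -/
lemma poissonInt_le {g : ℝ → ℝ≥0∞} (hg : Measurable g) {z : ℂ} (hz : 0 < z.re) {A : ℝ≥0∞}
    (h : ∀ r, z.re ≤ r → ∫⁻ t in Metric.closedBall z.im r, g t ≤ A * ENNReal.ofReal r) :
    poissonInt g z ≤ 8 * A := by
  calc poissonInt g z
      ≤ ∫⁻ t, ∑' j : ℕ, ENNReal.ofReal (4 * (1 / 4) ^ j / z.re) *
        (Metric.closedBall z.im (2 ^ j * z.re)).indicator g t := by
        refine lintegral_mono fun t => ?_
        refine (mul_le_mul_left (poisson_le_tsum hz z.im t) (g t)).trans ?_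
        rw [← ENNReal.tsum_mul_right]
        refine ENNReal.tsum_le_tsum fun j => ?_
        rw [mul_assoc]
        gcongr
        by_cases ht : t ∈ Metric.closedBall z.im (2 ^ j * z.re)
        · simp [indicator_of_mem ht]
        · simp [indicator_of_notMem ht]
    _ = ∑' j : ℕ, ENNReal.ofReal (4 * (1 / 4) ^ j / z.re) *
        ∫⁻ t in Metric.closedBall z.im (2 ^ j * z.re), g t := by
        rw [lintegral_tsum fun j => ((hg.indicator measurableSet_closedBall).const_mul _).aemeasurable]
        congr with j
        rw [lintegral_const_mul _ (hg.indicator measurableSet_closedBall),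
          lintegral_indicator measurableSet_closedBall]
    -- The weight `4 · 4^{-j} / x` times the radius `2^j x` leaves `4 · 2^{-j}`, which sums to `8`.
    _ ≤ ∑' j : ℕ, A * ENNReal.ofReal (4 * (1 / 2) ^ j) := by
        refine ENNReal.tsum_le_tsum fun j => ?_
        refine (mul_le_mul_right (h _ (le_mul_of_one_le_left hz.le
          (one_le_pow₀ one_le_two))) _).trans_eq ?_
        rw [mul_left_comm, ← ENNReal.ofReal_mul (by positivity)]
        congr 2
        have : (1 / 4 : ℝ) ^ j * 2 ^ j = (1 / 2) ^ j := by rw [← mul_pow]; norm_num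
        field_simp
        linarith
    _ = 8 * A := by
        have hs : Summable fun j : ℕ => (4 : ℝ) * (1 / 2) ^ j := summable_geometric_two.mul_left 4
        rw [ENNReal.tsum_mul_left, ← ENNReal.ofReal_tsum_of_nonneg (fun j => by positivity) hs,
          tsum_mul_left, tsum_geometric_two, mul_comm]
        norm_num

/-- An interval of radius `r` has length `2r`, so the previous bound applies with `A = 2c`. The
exact constant is `π`; the crude `16` only fixes the truncation level used below. -/
lemma poissonInt_le_of_le {g : ℝ → ℝ≥0∞} (hg : Measurable g) {z : ℂ} (hz : 0 < z.re) {c : ℝ≥0∞}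
    (h : ∀ t, g t ≤ c) : poissonInt g z ≤ 16 * c := by
  have := poissonInt_le hg hz (A := 2 * c) fun r _ => by
    refine (lintegral_mono h).trans ?_
    rw [setLIntegral_const, Real.volume_closedBall, ENNReal.ofReal_mul zero_le_two]
    simp only [ENNReal.ofReal_ofNat]
    rw [← mul_assoc, mul_comm c]
  rwa [← mul_assoc, show (8 : ℝ≥0∞) * 2 = 16 by norm_num] at this

lemma rpow_eq_rpow_sub_one_mul (x : ℝ≥0∞) {s : ℝ} (hs : 1 ≤ s) : x ^ s = x ^ (s - 1) * x := by
  have h := ENNReal.rpow_add_of_nonneg (x := x) (s - 1) 1 (by linarith) zero_le_one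
  rwa [sub_add_cancel, ENNReal.rpow_one] at h

/-- Superadditivity of `x ↦ x ^ s`: in `a_i^s = a_i^{s-1} a_i`, bound the first factor by the total
to the power `s - 1`. It allows the `s`-Carleson masses of the covering boxes to be added. -/
lemma tsum_rpow_le_rpow_tsum {α : Type*} (a : α → ℝ≥0∞) {s : ℝ} (hs : 1 ≤ s) :
    ∑' i, a i ^ s ≤ (∑' i, a i) ^ s := by
  calc ∑' i, a i ^ s ≤ ∑' i, (∑' i, a i) ^ (s - 1) * a i := by
        refine ENNReal.tsum_le_tsum fun i => ?_
        rw [rpow_eq_rpow_sub_one_mul _ hs]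
        exact mul_le_mul_left (ENNReal.rpow_le_rpow (ENNReal.le_tsum i) (by linarith)) _
    _ = (∑' i, a i) ^ s := by rw [ENNReal.tsum_mul_left, ← rpow_eq_rpow_sub_one_mul _ hs]

/-- The Poisson integral is of weak type `(1, s)` with respect to an `s`-Carleson family. -/
lemma measure_lt_poissonInt_le {ι : Type*} [Countable ι] [MeasurableSpace ι] {ν : Measure ι}
    {ζ : ι → ℂ} (hζ : ∀ k, 0 < (ζ k).re) {K : ℝ≥0∞} {s : ℝ} (hs : 1 ≤ s)
    (hC : IsCarlesonFamily ν ζ K s) {g : ℝ → ℝ≥0∞} (hg : Measurable g) (hgi : ∫⁻ t, g t ≠ ∞)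
    {α : ℝ} (hα : 0 < α) :
    ν {k | ENNReal.ofReal α < poissonInt g (ζ k)} ≤
      K * (40 * (∫⁻ t, g t) / ENNReal.ofReal α) ^ s := by
  set T := {k | ENNReal.ofReal α < poissonInt g (ζ k)} with hT
  -- Contrapositive of `poissonInt_le` with `A = α/8`: a large Poisson integral forces a large
  -- average of `g` over some interval of radius at least `Re ζ_k`. Membership in `T` sits inside
  -- the existential so that `r` can be chosen for all indices.
  have hex : ∀ k, ∃ r, k ∈ T → (ζ k).re ≤ r ∧
      ENNReal.ofReal (α / 8) * ENNReal.ofReal r < ∫⁻ t in Metric.closedBall (ζ k).im r, g t := by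
    intro k
    by_contra! hcon
    refine (hcon 0).1.not_ge ((poissonInt_le hg (hζ k) (A := ENNReal.ofReal (α / 8))
      fun r hr => (hcon r).2 hr).trans_eq ?_)
    rw [← ENNReal.ofReal_ofNat 8, ← ENNReal.ofReal_mul (by norm_num)]
    congr 1
    ring
  choose r hr using hex
  have hle : ∀ k ∈ T, ENNReal.ofReal (α / 8) * ENNReal.ofReal (r k) ≤ ∫⁻ t, g t := fun k hk =>
    (hr k hk).2.le.trans (setLIntegral_le_lintegral _ _)
  have hR : ∀ k ∈ T, r k ≤ (∫⁻ t, g t).toReal / (α / 8) := fun k hk => by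
    rw [le_div_iff₀ (by positivity), mul_comm]
    have h := hle k hk
    rw [← ENNReal.ofReal_mul (by positivity)] at h
    exact (ENNReal.ofReal_le_iff_le_toReal hgi).1 h
  -- Vitali selects disjoint intervals whose fivefold enlargements contain all the others. Comparing
  -- endpoints gives `r k ≤ 5 * r b`, hence `Re ζ_k ≤ 5 * r b`, so the Carleson boxes over the
  -- enlargements cover `T`. Disjointness bounds the total radius by `8 ∫ g / α`, whence `40 = 5 ·
  -- 8`.
  obtain ⟨u, huT, hdisj, hcov⟩ := Vitali.exists_disjoint_subfamily_covering_enlargement_closedBall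
    T (fun k => (ζ k).im) r _ hR 5 (by norm_num)
  have hsub : T ⊆ ⋃ b ∈ u, {k | |(ζ k).im - (ζ b).im| ≤ 5 * r b ∧ (ζ k).re ≤ 5 * r b} := by
    intro k hk
    obtain ⟨b, hb, hsub⟩ := hcov k hk
    have hrk : 0 < r k := (hζ k).trans_le (hr k hk).1
    have h1 : (ζ k).im + r k ∈ Metric.closedBall (ζ b).im (5 * r b) := hsub (by
      simp [Metric.mem_closedBall, abs_of_pos hrk])
    have h2 : (ζ k).im - r k ∈ Metric.closedBall (ζ b).im (5 * r b) := hsub (by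
      simp [Metric.mem_closedBall, abs_of_pos hrk])
    rw [Metric.mem_closedBall, Real.dist_eq, abs_le] at h1 h2
    refine mem_biUnion hb ⟨abs_le.2 ⟨by linarith, by linarith⟩, (hr k hk).1.trans (by linarith)⟩
  have hucount : u.Countable := u.to_countable
  have hsum : ENNReal.ofReal (α / 8) * ∑' b : u, ENNReal.ofReal (r b) ≤ ∫⁻ t, g t := by
    rw [← ENNReal.tsum_mul_left]
    calc _ ≤ ∑' b : u, ∫⁻ t in Metric.closedBall (ζ b).im (r b), g t :=
          ENNReal.tsum_le_tsum fun b => (hr b (huT b.2)).2.le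
      _ = ∫⁻ t in ⋃ b ∈ u, Metric.closedBall (ζ b).im (r b), g t :=
          (lintegral_biUnion hucount (fun _ _ => measurableSet_closedBall) hdisj _).symm
      _ ≤ _ := setLIntegral_le_lintegral _ _
  calc ν T ≤ ∑' b : u, ν {k | |(ζ k).im - (ζ b).im| ≤ 5 * r b ∧ (ζ k).re ≤ 5 * r b} :=
        (measure_mono hsub).trans (measure_biUnion_le ν hucount _)
    _ ≤ ∑' b : u, K * ENNReal.ofReal (5 * r b) ^ s := ENNReal.tsum_le_tsum fun b =>
        hC _ _ (by linarith [hζ b, (hr b (huT b.2)).1])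
    _ ≤ K * (∑' b : u, ENNReal.ofReal (5 * r b)) ^ s := by
        rw [ENNReal.tsum_mul_left]
        gcongr
        exact tsum_rpow_le_rpow_tsum _ hs
    _ ≤ K * (40 * (∫⁻ t, g t) / ENNReal.ofReal α) ^ s := by
        gcongr
        rw [ENNReal.le_div_iff_mul_le (Or.inl (by simpa using hα)) (Or.inl ENNReal.ofReal_ne_top)]
        calc _ = 40 * (ENNReal.ofReal (α / 8) * ∑' b : u, ENNReal.ofReal (r b)) := by
              rw [← ENNReal.tsum_mul_left, ← ENNReal.tsum_mul_left, ← ENNReal.tsum_mul_right]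
              congr with b
              rw [← ENNReal.ofReal_ofNat 40, ← ENNReal.ofReal_mul' hα.le,
                ← ENNReal.ofReal_mul (by positivity : 0 ≤ α / 8),
                ← ENNReal.ofReal_mul (by norm_num)]
              congr 1
              ring
          _ ≤ _ := by gcongr

/-! ### Real interpolation -/

/-- A strong type bound from the decay of the distribution function: real interpolation with one
endpoint into `L^∞`. -/
lemma lintegral_rpow_le_of_measure_lt_le {ι : Type*} [MeasurableSpace ι] {ν : Measure ι}
    {F : ι → ℝ} (hF : 0 ≤ F) (hFm : Measurable F) {q s e d m : ℝ} (hq : 0 < q) (hs : 1 ≤ s)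
    (hm : q - 1 + e + d * (s - 1) = m) {D E : ℝ≥0∞} {N : ℝ → ℝ≥0∞}
    (hN : ∀ α, 0 < α → N α ≤ E * ENNReal.ofReal (α ^ d))
    (hD : ∀ α, 0 < α → ν {k | α < F k} ≤ D * ENNReal.ofReal (α ^ e) * N α ^ s)
    (hNm : Measurable N) :
    ∫⁻ k, ENNReal.ofReal (F k ^ q) ∂ν ≤
      ENNReal.ofReal q * (D * E ^ (s - 1) *
        ∫⁻ α in Ioi (0 : ℝ), N α * ENNReal.ofReal (α ^ m)) := by
  rw [lintegral_rpow_eq_lintegral_meas_lt_mul ν (Eventually.of_forall hF) hFm.aemeasurable hq]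
  gcongr ENNReal.ofReal q * ?_
  rw [← lintegral_const_mul _ (by fun_prop)]
  refine setLIntegral_mono' measurableSet_Ioi fun α (hα : 0 < α) => ?_
  -- Only `N^{s-1}` is estimated pointwise. One linear factor `N` is kept, so that Fubini can later
  -- be applied to `∫ N(α) α^m dα`.
  have h1 : N α ^ s ≤ E ^ (s - 1) * ENNReal.ofReal (α ^ (d * (s - 1))) * N α := by
    rw [rpow_eq_rpow_sub_one_mul _ hs]
    refine mul_le_mul_left ?_ _
    refine (ENNReal.rpow_le_rpow (hN α hα) (by linarith)).trans_eq ?_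
    rw [ENNReal.mul_rpow_of_nonneg _ _ (by linarith),
      ENNReal.ofReal_rpow_of_nonneg (by positivity) (by linarith), ← Real.rpow_mul hα.le]
  calc ν {k | α < F k} * ENNReal.ofReal (α ^ (q - 1))
      ≤ D * ENNReal.ofReal (α ^ e) * (E ^ (s - 1) * ENNReal.ofReal (α ^ (d * (s - 1))) * N α) *
        ENNReal.ofReal (α ^ (q - 1)) := by
        refine mul_le_mul_left ((hD α hα).trans ?_) _
        gcongr
    _ = D * E ^ (s - 1) * (N α * (ENNReal.ofReal (α ^ (q - 1)) * ENNReal.ofReal (α ^ e) *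
        ENNReal.ofReal (α ^ (d * (s - 1))))) := by ring
    _ = _ := by
        rw [← ENNReal.ofReal_mul (by positivity), ← ENNReal.ofReal_mul (by positivity),
          ← Real.rpow_add hα, ← Real.rpow_add hα, hm]

lemma measurable_setLIntegral_superlevel {f : ℝ → ℝ≥0∞} (hf : Measurable f) {g : ℝ → ℝ≥0∞}
    (hg : Measurable g) {c : ℝ → ℝ≥0∞} (hc : Measurable c) :
    Measurable fun α => ∫⁻ t in {t | c α < f t}, g t := by
  have h : ∀ α, ∫⁻ t in {t | c α < f t}, g t
      = ∫⁻ t, {p : ℝ × ℝ | c p.1 < f p.2}.indicator (fun p => g p.2) (α, t) := fun α => by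
    rw [← lintegral_indicator (measurableSet_lt measurable_const hf)]
    rfl
  simp_rw [h]
  refine Measurable.lintegral_prod_right' (Measurable.indicator (by fun_prop) ?_)
  exact measurableSet_lt (hc.comp measurable_fst) (hf.comp measurable_snd)

/-- `L² → L^{2s}` boundedness of the Poisson integral with respect to an `s`-Carleson family. -/
lemma lintegral_rpow_le_of_le_poissonInt {ι : Type*} [Countable ι] [MeasurableSpace ι]
    {ν : Measure ι} {ζ : ι → ℂ} (hζ : ∀ k, 0 < (ζ k).re) {K : ℝ≥0∞} {s : ℝ} (hs : 1 ≤ s)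
    (hC : IsCarlesonFamily ν ζ K s) {f : ℝ → ℝ≥0∞} (hf : Measurable f)
    (hf2 : ∫⁻ t, f t ^ 2 ≠ ∞) {F : ι → ℝ} (hF : 0 ≤ F) (hFm : Measurable F)
    (hFf : ∀ k, ENNReal.ofReal (F k) ≤ poissonInt f (ζ k)) :
    ∫⁻ k, ENNReal.ofReal (F k ^ (2 * s)) ∂ν ≤
      ENNReal.ofReal (2 * s) * (K * 80 ^ s) * 32 ^ s * (∫⁻ t, f t ^ 2) ^ s := by
  -- Truncation at height `α/32`: the part of `f` below it has Poisson integral at most `16 · α/32 =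
  -- α/2`, so where `F > α` the part above it has Poisson integral greater than `α/2`. `N` is the
  -- `L¹` norm of that upper part, to which the weak type bound applies.
  set N : ℝ → ℝ≥0∞ := fun α => ∫⁻ t in {t | ENNReal.ofReal (α / 32) < f t}, f t 
  have hNm : Measurable N := measurable_setLIntegral_superlevel hf hf (by fun_prop)
  have hmeas : ∀ α : ℝ, MeasurableSet {t | ENNReal.ofReal (α / 32) < f t} := fun α =>
    measurableSet_lt measurable_const hf
  have hNle : ∀ α : ℝ, 0 < α → ENNReal.ofReal (α / 32) * N α ≤ ∫⁻ t, f t ^ 2 := fun α hα => by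
    rw [← lintegral_const_mul _ hf]
    refine (setLIntegral_mono' (g := fun t => f t ^ 2) (hmeas α) fun t ht => ?_).trans
      (setLIntegral_le_lintegral _ _)
    rw [sq]
    exact mul_le_mul_left (le_of_lt ht) _
  have hN : ∀ α : ℝ, 0 < α → N α ≤ 32 * (∫⁻ t, f t ^ 2) * ENNReal.ofReal (α ^ (-1 : ℝ)) := by
    intro α hα
    have h := mul_le_mul_right (hNle α hα) (ENNReal.ofReal (32 * α⁻¹))
    rw [← mul_assoc, ← ENNReal.ofReal_mul (by positivity),
      show 32 * α⁻¹ * (α / 32) = 1 by field_simp, ENNReal.ofReal_one, one_mul] at h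
    refine h.trans_eq ?_
    rw [Real.rpow_neg_one, ENNReal.ofReal_mul (by norm_num), ENNReal.ofReal_ofNat]
    ring
  have hD : ∀ α : ℝ, 0 < α → ν {k | α < F k} ≤
      K * 80 ^ s * ENNReal.ofReal (α ^ (-s)) * N α ^ s := by
    intro α hα
    set g := {t | ENNReal.ofReal (α / 32) < f t}.indicator f
    have hg : Measurable g := hf.indicator (hmeas α)
    have hgN : ∫⁻ t, g t = N α := lintegral_indicator (hmeas α) _
    have hsub : {k | α < F k} ⊆ {k | ENNReal.ofReal (α / 2) < poissonInt g (ζ k)} := by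
      intro k hk
      set h := {t | ENNReal.ofReal (α / 32) < f t}ᶜ.indicator f
      have hh : Measurable h := hf.indicator (hmeas α).compl
      have h1 : poissonInt f (ζ k) = poissonInt g (ζ k) + poissonInt h (ζ k) := by
        unfold poissonInt
        rw [← lintegral_add_left (by fun_prop)]
        congr with t
        rw [← mul_add]
        congr 1
        exact (congrFun (indicator_self_add_compl {t | ENNReal.ofReal (α / 32) < f t} f) t).symm
      have h2 : poissonInt h (ζ k) ≤ ENNReal.ofReal (α / 2) := by
        refine (poissonInt_le_of_le hh (hζ k) (c := ENNReal.ofReal (α / 32)) fun t => ?_).trans_eq ?_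
        · by_cases ht : ENNReal.ofReal (α / 32) < f t
          · simp [h, ht]
          · simpa [h, ht] using not_lt.1 ht
        · rw [← ENNReal.ofReal_ofNat 16, ← ENNReal.ofReal_mul (by norm_num)]
          congr 1
          ring
      by_contra hcon
      have h3 : ENNReal.ofReal (F k) ≤ ENNReal.ofReal α := by
        refine ((hFf k).trans_eq h1).trans ((add_le_add (not_lt.1 hcon) h2).trans_eq ?_)
        rw [← ENNReal.ofReal_add (by positivity) (by positivity), add_halves]
      exact (not_lt.2 ((ENNReal.ofReal_le_ofReal_iff hα.le).1 h3)) hk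
    have hgi : ∫⁻ t, g t ≠ ∞ := by
      rw [hgN]
      exact ((hN α hα).trans_lt (ENNReal.mul_lt_top (ENNReal.mul_lt_top (by simp) hf2.lt_top)
        ENNReal.ofReal_lt_top)).ne
    refine (measure_mono hsub).trans
      ((measure_lt_poissonInt_le hζ hs hC hg hgi (half_pos hα)).trans_eq ?_)
    have h0 : (0 : ℝ) ≤ s := by linarith
    have e : 40 * N α / ENNReal.ofReal (α / 2) = 80 * ENNReal.ofReal α⁻¹ * N α := by
      rw [div_eq_mul_inv, ← ENNReal.ofReal_inv_of_pos (half_pos hα), inv_div, div_eq_mul_inv,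
        ENNReal.ofReal_mul zero_le_two, ENNReal.ofReal_ofNat]
      ring
    rw [hgN, e, ENNReal.mul_rpow_of_nonneg _ _ h0, ENNReal.mul_rpow_of_nonneg _ _ h0,
      ENNReal.ofReal_rpow_of_nonneg (by positivity) h0, Real.inv_rpow hα.le, Real.rpow_neg hα.le]
    ring
  -- Fubini: for fixed `t`, the condition `α/32 < f t` confines `α` to an interval of length `32 f
  -- t`, producing `32 (f t)²`.
  have hW : ∫⁻ α in Ioi (0 : ℝ), N α * ENNReal.ofReal (α ^ (0 : ℝ)) ≤ 32 * ∫⁻ t, f t ^ 2 := by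
    have h : ∀ α, N α * ENNReal.ofReal (α ^ (0 : ℝ))
        = ∫⁻ t, {p : ℝ × ℝ | ENNReal.ofReal (p.1 / 32) < f p.2}.indicator (fun p => f p.2) (α, t) :=
      fun α => by
        rw [Real.rpow_zero, ENNReal.ofReal_one, mul_one]
        exact (lintegral_indicator (hmeas α) _).symm
    have hG : Measurable
        ({p : ℝ × ℝ | ENNReal.ofReal (p.1 / 32) < f p.2}.indicator fun p => f p.2) :=
      Measurable.indicator (by fun_prop) (measurableSet_lt (by fun_prop) (by fun_prop))
    simp_rw [h]
    rw [lintegral_lintegral_swap (f := fun α t =>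
      {p : ℝ × ℝ | ENNReal.ofReal (p.1 / 32) < f p.2}.indicator (fun p => f p.2) (α, t))
      hG.aemeasurable, ← lintegral_const_mul _ (by fun_prop)]
    refine lintegral_mono fun t => ?_
    have hset : MeasurableSet {α : ℝ | ENNReal.ofReal (α / 32) < f t} :=
      measurableSet_lt (by fun_prop) measurable_const
    calc ∫⁻ α in Ioi (0 : ℝ),
          {p : ℝ × ℝ | ENNReal.ofReal (p.1 / 32) < f p.2}.indicator (fun p => f p.2) (α, t)
        = f t * volume ({α : ℝ | ENNReal.ofReal (α / 32) < f t} ∩ Ioi 0) := by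
          rw [← Measure.restrict_apply hset, ← setLIntegral_const, ← lintegral_indicator hset]
          rfl
      _ ≤ f t * (32 * f t) := by
          gcongr
          rcases eq_or_ne (f t) ∞ with ht | ht
          · simp [ht]
          calc _ ≤ volume (Ioc (0 : ℝ) (32 * (f t).toReal)) := measure_mono fun α hα => by
                refine ⟨hα.2, ?_⟩
                have : α / 32 < (f t).toReal := (ENNReal.ofReal_lt_iff_lt_toReal
                  (div_nonneg hα.2.le (by norm_num)) ht).1 hα.1
                linarith
            _ = _ := by
                rw [Real.volume_Ioc, sub_zero, ENNReal.ofReal_mul (by norm_num : (0 : ℝ) ≤ 32),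
                  ENNReal.ofReal_toReal ht, ENNReal.ofReal_ofNat]
      _ = 32 * f t ^ 2 := by ring
  refine (lintegral_rpow_le_of_measure_lt_le hF hFm (by linarith : 0 < 2 * s) hs
    (by ring : 2 * s - 1 + -s + -1 * (s - 1) = 0) hN hD hNm).trans ?_
  calc _ ≤ ENNReal.ofReal (2 * s) * (K * 80 ^ s * (32 * ∫⁻ t, f t ^ 2) ^ (s - 1) *
        (32 * ∫⁻ t, f t ^ 2)) := by gcongr
    _ = _ := by
        rw [mul_assoc (K * 80 ^ s), ← rpow_eq_rpow_sub_one_mul _ hs,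
          ENNReal.mul_rpow_of_nonneg _ _ (by linarith)]
        ring

/-! ### Plancherel and Poisson representation for the Laplace transform -/

section Fourier

open scoped FourierTransform ContDiff

lemma continuous_fourier {f : ℝ → ℂ} (hf : Integrable f) : Continuous (𝓕 f) :=
  VectorFourier.fourierIntegral_continuous Real.continuous_fourierChar
    (L := innerₗ ℝ) continuous_inner hf

/-- The Fourier integral of a function in `L¹ ∩ L²` is its `L²` Fourier transform. -/
lemma fourier_toLp_ae_eq {f : ℝ → ℂ} (hf : Integrable f) (hf2 : MemLp f 2) :
    (𝓕 (hf2.toLp f) : Lp ℂ 2 (volume : Measure ℝ)) =ᵐ[volume] 𝓕 f := by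
  set G : Lp ℂ 2 (volume : Measure ℝ) := 𝓕 (hf2.toLp f)
  refine ae_eq_of_integral_contDiff_smul_eq
    ((Lp.memLp G).locallyIntegrable one_le_two) (continuous_fourier hf).locallyIntegrable ?_
  intro g g_smooth g_cpt
  have hg₁ : HasCompactSupport (Complex.ofRealCLM ∘ g) := g_cpt.comp_left rfl
  have hg₂ : ContDiff ℝ ∞ (Complex.ofRealCLM ∘ g) := by fun_prop
  set φ : SchwartzMap ℝ ℂ := hg₁.toSchwartzMap hg₂
  have hφ : ∀ x, φ x = (g x : ℂ) := fun x => rfl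
  have e1 : ∫ x, g x • G x = ∫ x, φ x • G x := by simp [hφ]
  have e2 : ∫ x, g x • 𝓕 f x = ∫ x, φ x • 𝓕 f x := by simp [hφ]
  -- Both pairings reduce to `∫ (𝓕 φ) f`: the `L²` one because its transform agrees with that of
  -- tempered distributions, the integral one by the multiplication formula.
  rw [e1, e2, ← Lp.toTemperedDistribution_apply G φ, ← Lp.fourier_toTemperedDistribution_eq,
    TemperedDistribution.fourier_apply, Lp.toTemperedDistribution_apply]
  have e3 : ∫ x, (𝓕 φ) x • (hf2.toLp f) x = ∫ x, (𝓕 φ) x • f x := by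
    refine integral_congr_ae ?_
    filter_upwards [hf2.coeFn_toLp] with x hx
    rw [hx]
  rw [e3]
  have := VectorFourier.integral_fourierIntegral_smul_eq_flip (L := innerₗ ℝ) (μ := volume)
    (ν := volume) Real.continuous_fourierChar continuous_inner φ.integrable hf
  simpa using! this

lemma lintegral_enorm_fourier_sq {f : ℝ → ℂ} (hf : Integrable f) (hf2 : MemLp f 2) :
    ∫⁻ w, ‖𝓕 f w‖ₑ ^ 2 = ∫⁻ t, ‖f t‖ₑ ^ 2 := by
  have h : eLpNorm (𝓕 f) 2 volume = eLpNorm f 2 volume := by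
    rw [← eLpNorm_congr_ae (fourier_toLp_ae_eq hf hf2), ← eLpNorm_congr_ae hf2.coeFn_toLp]
    have := Lp.norm_fourier_eq (hf2.toLp f)
    rw [Lp.norm_def, Lp.norm_def, ENNReal.toReal_eq_toReal_iff' (Lp.eLpNorm_ne_top _)
      (Lp.eLpNorm_ne_top _)] at this
    exact this
  have h2 : ∀ g : ℝ → ℂ, ∫⁻ w, ‖g w‖ₑ ^ 2 = eLpNorm g 2 volume ^ 2 := fun g => by
    have := eLpNorm_nnreal_pow_eq_lintegral (f := g) (μ := volume) (p := 2) two_ne_zero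
    simp only [NNReal.coe_ofNat, ENNReal.rpow_ofNat, ENNReal.coe_ofNat] at this
    exact this.symm
  rw [h2, h2, h]

/-- The Fourier transform of `exp (-x|v|)`. -/
lemma fourier_exp_neg_mul_abs {x : ℝ} (hx : 0 < x) :
    Integrable (fun v : ℝ => Complex.exp (-(x * |v| : ℝ))) ∧
    ∀ w : ℝ, 𝓕 (fun v : ℝ => Complex.exp (-(x * |v| : ℝ))) w =
      ((2 * x / (x ^ 2 + (2 * Real.pi * w) ^ 2) : ℝ) : ℂ) := by
  have key : ∀ w : ℝ, Integrable (fun v : ℝ => Complex.exp (↑(-2 * Real.pi * v * w) * Complex.I) •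
      Complex.exp (-(x * |v| : ℝ))) ∧
      ∫ v : ℝ, Complex.exp (↑(-2 * Real.pi * v * w) * Complex.I) •
        Complex.exp (-(x * |v| : ℝ)) = ((2 * x / (x ^ 2 + (2 * Real.pi * w) ^ 2) : ℝ) : ℂ) := by
    intro w
    -- The integrand is `exp (a v)` on `v ≤ 0` and `exp (c v)` on `v > 0`; the two half-lines
    -- contribute `1/a` and `-1/c`.
    set a : ℂ := x - 2 * Real.pi * w * Complex.I with ha
    set c : ℂ := -x - 2 * Real.pi * w * Complex.I with hc
    have hare : a.re = x := by simp [ha]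
    have hcre : c.re = -x := by simp [hc]
    have e1 : EqOn (fun v : ℝ => Complex.exp (a * v)) (fun v : ℝ =>
        Complex.exp (↑(-2 * Real.pi * v * w) * Complex.I) • Complex.exp (-(x * |v| : ℝ)))
        (Iic 0) := fun v hv => by
      simp only [smul_eq_mul, ← Complex.exp_add]
      rw [abs_of_nonpos hv, ha]
      push_cast
      ring_nf
    have e2 : EqOn (fun v : ℝ => Complex.exp (c * v)) (fun v : ℝ =>
        Complex.exp (↑(-2 * Real.pi * v * w) * Complex.I) • Complex.exp (-(x * |v| : ℝ)))
        (Ioi 0) := fun v hv => by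
      simp only [smul_eq_mul, ← Complex.exp_add]
      rw [abs_of_pos hv, hc]
      push_cast
      ring_nf
    have i1 := (integrableOn_exp_mul_complex_Iic (a := a) (by linarith) 0).congr_fun e1
      measurableSet_Iic
    have i2 := (integrableOn_exp_mul_complex_Ioi (a := c) (by linarith) 0).congr_fun e2
      measurableSet_Ioi
    refine ⟨by rw [← integrableOn_univ, ← Iic_union_Ioi (a := (0 : ℝ))]; exact i1.union i2, ?_⟩
    rw [← intervalIntegral.integral_Iic_add_Ioi i1 i2, ← setIntegral_congr_fun measurableSet_Iic e1,
      ← setIntegral_congr_fun measurableSet_Ioi e2, integral_exp_mul_complex_Iic (by linarith),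
      integral_exp_mul_complex_Ioi (by linarith)]
    have ha0 : a ≠ 0 := fun h => by simp [h] at hare; linarith
    have hc0 : c ≠ 0 := fun h => by simp [h] at hcre; linarith
    have hac : a * c = -((x ^ 2 + (2 * Real.pi * w) ^ 2 : ℝ) : ℂ) := by
      rw [ha, hc]
      push_cast
      ring_nf
      simp only [Complex.I_sq]
      ring
    have hd : ((x ^ 2 + (2 * Real.pi * w) ^ 2 : ℝ) : ℂ) ≠ 0 := by
      exact_mod_cast (by positivity : (0 : ℝ) < x ^ 2 + (2 * Real.pi * w) ^ 2).ne'
    rw [Complex.ofReal_div, div_add_div _ _ ha0 hc0, hac, div_eq_div_iff (neg_ne_zero.2 hd) hd]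
    simp only [Complex.ofReal_zero, mul_zero, Complex.exp_zero, ha, hc]
    push_cast
    ring
  refine ⟨?_, fun w => ?_⟩
  · have := (key 0).1
    simpa using this
  · rw [Real.fourier_real_eq_integral_exp_smul]
    exact (key w).2

lemma integrable_poisson {x : ℝ} (hx : 0 < x) (y : ℝ) :
    Integrable fun t : ℝ => x / (x ^ 2 + (y - t) ^ 2) := by
  have h := ((integrable_inv_one_add_sq.comp_div hx.ne').const_mul x⁻¹).comp_sub_left y
  refine h.congr (Eventually.of_forall fun t => ?_)
  have : x ^ 2 + (y - t) ^ 2 ≠ 0 := by positivity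
  field_simp

/-- The Poisson kernel reproduces the exponentials `exp (-z t)`, `t ≥ 0`. -/
lemma exp_neg_mul_eq_integral_poisson {z : ℂ} (hz : 0 < z.re) {t : ℝ} (ht : 0 ≤ t) :
    Complex.exp (-(z * t)) = (Real.pi : ℂ)⁻¹ * ∫ s : ℝ,
      ((z.re / (z.re ^ 2 + (z.im - s) ^ 2) : ℝ) : ℂ) * Complex.exp (-(s * Complex.I * t)) := by
  obtain ⟨hi, hF⟩ := fourier_exp_neg_mul_abs hz
  have hpi : (Real.pi : ℂ) ≠ 0 := by exact_mod_cast Real.pi_ne_zero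
  set G : ℝ → ℂ := fun σ =>
    ((z.re / (z.re ^ 2 + σ ^ 2) : ℝ) : ℂ) * Complex.exp (σ * t * Complex.I) with hG
  have hFi : Integrable (𝓕 (fun v : ℝ => Complex.exp (-(z.re * |v| : ℝ)))) := by
    have h := ((integrable_poisson hz 0).comp_mul_left' (R := 2 * Real.pi)
      (by positivity)).const_mul 2
    refine h.ofReal.congr (Eventually.of_forall fun w => ?_)
    rw [hF]
    simp only [zero_sub, neg_sq, mul_div_assoc]
    rfl
  -- Fourier inversion for `exp (-x|v|)` at `t ≥ 0`, where `|t| = t`. Rescaling by `2π` and then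
  -- substituting `σ = Im z - s` turns this into the Poisson formula, the shift supplying the factor
  -- `exp (i t Im z)`.
  have h1 := congrFun (Continuous.fourierInv_fourier_eq (by fun_prop) hi hFi) t
  rw [Real.fourierInv_eq'] at h1
  have h2 : ∫ v : ℝ, Complex.exp (↑(2 * Real.pi * inner ℝ v t) * Complex.I) •
      𝓕 (fun v : ℝ => Complex.exp (-(z.re * |v| : ℝ))) v = ∫ v, 2 * G ((2 * Real.pi) * v) := by
    congr with v
    rw [hF, hG]
    simp only [smul_eq_mul, RCLike.inner_apply, conj_trivial]
    push_cast
    ring_nf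
  rw [h2, integral_const_mul, Measure.integral_comp_mul_left G,
    ← integral_sub_left_eq_self G volume z.im] at h1
  have h3 : ∀ s : ℝ, G (z.im - s) = Complex.exp (z.im * t * Complex.I) *
      (((z.re / (z.re ^ 2 + (z.im - s) ^ 2) : ℝ) : ℂ) * Complex.exp (-(s * Complex.I * t))) := by
    intro s
    rw [hG, mul_left_comm, ← Complex.exp_add]
    push_cast
    ring_nf
  simp_rw [h3] at h1
  rw [integral_const_mul, abs_of_nonneg ht] at h1
  set J := ∫ s : ℝ,
      ((z.re / (z.re ^ 2 + (z.im - s) ^ 2) : ℝ) : ℂ) * Complex.exp (-(s * Complex.I * t))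
  have h4 : Complex.exp (-(z * t)) = Complex.exp (-(z.im * t * Complex.I)) *
      Complex.exp (-((z.re * t : ℝ) : ℂ)) := by
    rw [← Complex.exp_add]
    congr 1
    conv_lhs => rw [← Complex.re_add_im z]
    push_cast
    ring
  rw [h4, ← h1, abs_of_pos (by positivity), Complex.real_smul]
  have h5 : Complex.exp (-(z.im * t * Complex.I)) * Complex.exp (z.im * t * Complex.I) = 1 := by
    rw [← Complex.exp_add, neg_add_cancel, Complex.exp_zero]
  push_cast
  calc _ = (Complex.exp (-(z.im * t * Complex.I)) * Complex.exp (z.im * t * Complex.I)) *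
        ((2 * (2 * (Real.pi : ℂ))⁻¹) * J) := by ring
    _ = _ := by rw [h5, one_mul]; congr 1; field_simp

end Fourier

/-! ### The Laplace transform on the half-plane and its boundary values -/

/-- The Laplace transform of a function on `(0, ∞)`. -/
noncomputable def laplace (u : ℝ → ℂ) (z : ℂ) : ℂ :=
  ∫ t in Ioi (0 : ℝ), Complex.exp (-(z * t)) * u t

lemma norm_exp_neg_mul_le {z : ℂ} (hz : 0 ≤ z.re) {t : ℝ} (ht : 0 ≤ t) :
    ‖Complex.exp (-(z * t))‖ ≤ 1 := by
  rw [Complex.norm_exp, Complex.neg_re, Complex.re_mul_ofReal, Real.exp_le_one_iff]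
  exact neg_nonpos.2 (mul_nonneg hz ht)

lemma integrableOn_exp_neg_mul {u : ℝ → ℂ} (hu : IntegrableOn u (Ioi 0)) {z : ℂ}
    (hz : 0 ≤ z.re) : IntegrableOn (fun t : ℝ => Complex.exp (-(z * t)) * u t) (Ioi 0) := by
  refine hu.bdd_mul (c := 1) (Continuous.aestronglyMeasurable (by fun_prop)) ?_
  filter_upwards [ae_restrict_mem measurableSet_Ioi] with t ht
  exact norm_exp_neg_mul_le hz (le_of_lt ht)

lemma laplace_mul_I_eq_fourier (u : ℝ → ℂ) (y : ℝ) :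
    laplace u (y * Complex.I) = FourierTransform.fourier ((Ioi (0 : ℝ)).indicator u)
      ((2 * Real.pi)⁻¹ * y) := by
  rw [Real.fourier_real_eq_integral_exp_smul, laplace, ← integral_indicator measurableSet_Ioi]
  congr with t
  by_cases ht : t ∈ Ioi (0 : ℝ)
  · rw [indicator_of_mem ht, indicator_of_mem ht, smul_eq_mul]
    congr 2
    have : (Real.pi : ℂ) ≠ 0 := by exact_mod_cast Real.pi_ne_zero
    push_cast
    field_simp
  · simp [indicator_of_notMem ht]

lemma continuous_laplace_mul_I {u : ℝ → ℂ} (hu : IntegrableOn u (Ioi 0)) :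
    Continuous fun y : ℝ => laplace u (y * Complex.I) := by
  simp_rw [laplace_mul_I_eq_fourier]
  exact (continuous_fourier ((integrable_indicator_iff measurableSet_Ioi).2 hu)).comp
    (continuous_const_mul _)

/-- Plancherel's theorem for the Laplace transform on the imaginary axis. -/
lemma lintegral_enorm_laplace_mul_I_sq {u : ℝ → ℂ} (hu : IntegrableOn u (Ioi 0))
    (hu2 : MemLp u 2 (volume.restrict (Ioi 0))) :
    ∫⁻ y : ℝ, ‖laplace u (y * Complex.I)‖ₑ ^ 2 =
      ENNReal.ofReal (2 * Real.pi) * ∫⁻ t in Ioi 0, ‖u t‖ₑ ^ 2 := by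
  set f := (Ioi (0 : ℝ)).indicator u
  have hf : Integrable f := (integrable_indicator_iff measurableSet_Ioi).2 hu
  have hf2 : MemLp f 2 := (memLp_indicator_iff_restrict measurableSet_Ioi).2 hu2
  have hpi : (2 * Real.pi)⁻¹ ≠ 0 := by positivity
  simp_rw [laplace_mul_I_eq_fourier]
  have h1 : ∫⁻ y : ℝ, ‖FourierTransform.fourier f ((2 * Real.pi)⁻¹ * y)‖ₑ ^ 2 =
      ∫⁻ w, ‖FourierTransform.fourier f w‖ₑ ^ 2 ∂(Measure.map ((2 * Real.pi)⁻¹ * ·) volume) := by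
    rw [lintegral_map _ (by fun_prop)]
    exact ((continuous_fourier hf).enorm.measurable.pow_const 2)
  rw [h1, Real.map_volume_mul_left hpi, lintegral_smul_measure, lintegral_enorm_fourier_sq hf hf2,
    inv_inv, abs_of_pos (by positivity), smul_eq_mul, ← lintegral_indicator measurableSet_Ioi]
  congr with t
  by_cases ht : t ∈ Ioi (0 : ℝ)
  · simp [f, indicator_of_mem ht]
  · simp [f, indicator_of_notMem ht]

/-- The Laplace transform is dominated by the Poisson integral of its boundary values. -/
lemma enorm_laplace_le_poissonInt {u : ℝ → ℂ} (hu : IntegrableOn u (Ioi 0)) {z : ℂ}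
    (hz : 0 < z.re) :
    ‖laplace u z‖ₑ ≤ poissonInt (fun y : ℝ => ‖laplace u (y * Complex.I)‖ₑ) z := by
  set P : ℝ → ℝ := fun s => z.re / (z.re ^ 2 + (z.im - s) ^ 2) with hP
  have hP0 : ∀ s, 0 ≤ P s := fun s => by positivity
  -- Insert the Poisson formula for `e^{-zt}` and exchange the integrals. This is legitimate because
  -- `u` and the Poisson kernel are integrable and the exponential is unimodular on the imaginary
  -- axis.
  have h1 : laplace u z = (Real.pi : ℂ)⁻¹ *
      ∫ s : ℝ, (P s : ℂ) * laplace u (s * Complex.I) := by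
    calc laplace u z = ∫ t in Ioi (0 : ℝ), (Real.pi : ℂ)⁻¹ *
          ∫ s : ℝ, (P s : ℂ) * Complex.exp (-(s * Complex.I * t)) * u t := by
          refine setIntegral_congr_fun measurableSet_Ioi fun t ht => ?_
          rw [integral_mul_const, exp_neg_mul_eq_integral_poisson hz (le_of_lt ht), mul_assoc]
      _ = (Real.pi : ℂ)⁻¹ * ∫ s : ℝ, ∫ t in Ioi (0 : ℝ),
          (P s : ℂ) * Complex.exp (-(s * Complex.I * t)) * u t := by
          rw [integral_const_mul, integral_integral_swap]
          have hPi : Integrable fun s => (P s : ℂ) := (integrable_poisson hz z.im).ofReal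
          have hi := Integrable.mul_prod hu hPi
          have hi2 := hi.bdd_mul (c := 1)
            (f := fun p : ℝ × ℝ => Complex.exp (-(p.2 * Complex.I * p.1)))
            (Continuous.aestronglyMeasurable (by fun_prop)) (Eventually.of_forall fun p => by
              rw [Complex.norm_exp]; simp)
          refine hi2.congr (Eventually.of_forall fun p => ?_)
          simp only [Function.uncurry, hP]
          push_cast
          ring
      _ = _ := by
          congr 1
          refine integral_congr_ae (Eventually.of_forall fun s => ?_)
          simp only [mul_assoc]
          rw [integral_const_mul]
          simp only [laplace, mul_assoc]
  rw [h1, enorm_mul]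
  -- `poissonInt` omits the normalising factor `1/π`, which may be discarded here since it is at
  -- most `1`.
  have h2 : ‖(Real.pi : ℂ)⁻¹‖ₑ ≤ 1 := by
    rw [← ofReal_norm, ENNReal.ofReal_le_one, norm_inv, Complex.norm_real,
      Real.norm_of_nonneg Real.pi_pos.le]
    exact inv_le_one_of_one_le₀ (by linarith [Real.pi_gt_three])
  refine (mul_le_of_le_one_left' h2).trans ((enorm_integral_le_lintegral_enorm _).trans_eq ?_)
  refine lintegral_congr fun s => ?_
  rw [enorm_mul]
  congr 1
  rw [← ofReal_norm, Complex.norm_real, Real.norm_of_nonneg (hP0 s)]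

/-- The Laplace–Carleson embedding for `p = 2`, on a dense subspace. -/
lemma lintegral_laplace_rpow_le_two {ι : Type*} [Countable ι] [MeasurableSpace ι]
    [DiscreteMeasurableSpace ι] {ν : Measure ι} {ζ : ι → ℂ} (hζ : ∀ k, 0 < (ζ k).re) {K : ℝ≥0∞}
    {s : ℝ} (hs : 1 ≤ s) (hC : IsCarlesonFamily ν ζ K s) {u : ℝ → ℂ}
    (hu : IntegrableOn u (Ioi 0)) (hu2 : MemLp u 2 (volume.restrict (Ioi 0))) :
    ∫⁻ k, ENNReal.ofReal (‖laplace u (ζ k)‖ ^ (2 * s)) ∂ν ≤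
      ENNReal.ofReal (2 * s) * (K * 80 ^ s) * 32 ^ s * ENNReal.ofReal (2 * Real.pi) ^ s *
        (∫⁻ t in Ioi 0, ‖u t‖ₑ ^ 2) ^ s := by
  have hP := lintegral_enorm_laplace_mul_I_sq hu hu2
  have h2 : ∫⁻ t in Ioi 0, ‖u t‖ₑ ^ 2 ≠ ∞ := by
    have := eLpNorm_nnreal_pow_eq_lintegral (f := u) (μ := volume.restrict (Ioi 0)) (p := 2)
      two_ne_zero
    simp only [NNReal.coe_ofNat, ENNReal.rpow_ofNat, ENNReal.coe_ofNat] at this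
    rw [← this]
    exact ENNReal.pow_ne_top hu2.2.ne
  refine (lintegral_rpow_le_of_le_poissonInt hζ hs hC
    (f := fun y : ℝ => ‖laplace u (y * Complex.I)‖ₑ)
    (continuous_laplace_mul_I hu).enorm.measurable ?_ (fun k => norm_nonneg _)
    (Measurable.of_discrete) fun k => ?_).trans_eq ?_
  · rw [hP]
    exact ENNReal.mul_ne_top ENNReal.ofReal_ne_top h2
  · rw [ofReal_norm]
    exact enorm_laplace_le_poissonInt hu (hζ k)
  · rw [hP, ENNReal.mul_rpow_of_nonneg _ _ (by linarith)]
    ring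

/-! ### The Laplace–Carleson embedding for `1 < p ≤ 2` -/

/-- The `L¹ → L^∞` endpoint of the interpolation, from `|e^{-zt}| ≤ 1`. -/
lemma enorm_laplace_le_lintegral {u : ℝ → ℂ} {z : ℂ} (hz : 0 ≤ z.re) :
    ‖laplace u z‖ₑ ≤ ∫⁻ t in Ioi 0, ‖u t‖ₑ := by
  refine (enorm_integral_le_lintegral_enorm _).trans ?_
  refine setLIntegral_mono' measurableSet_Ioi fun t ht => ?_
  rw [enorm_mul]
  refine mul_le_of_le_one_left' ?_
  rw [← ofReal_norm, ENNReal.ofReal_le_one]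
  exact norm_exp_neg_mul_le hz (le_of_lt ht)

lemma laplace_add {u v : ℝ → ℂ} (hu : IntegrableOn u (Ioi 0)) (hv : IntegrableOn v (Ioi 0)) {z : ℂ}
    (hz : 0 ≤ z.re) : laplace (u + v) z = laplace u z + laplace v z := by
  rw [laplace, laplace, laplace,
    ← integral_add (integrableOn_exp_neg_mul hu hz) (integrableOn_exp_neg_mul hv hz)]
  simp only [Pi.add_apply, mul_add]

lemma lintegral_rpow_Ioc {c δ : ℝ} (hc : 0 ≤ c) (hδ : 0 < δ) :
    ∫⁻ α in Ioc (0 : ℝ) c, ENNReal.ofReal (α ^ (δ - 1)) = ENNReal.ofReal (c ^ δ / δ) := by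
  have h1 : IntervalIntegrable (fun α : ℝ => α ^ (δ - 1)) volume 0 c :=
    intervalIntegral.intervalIntegrable_rpow' (by linarith)
  rw [← ofReal_integral_eq_lintegral_ofReal
    ((intervalIntegrable_iff_integrableOn_Ioc_of_le hc).1 h1) ?_,
    ← intervalIntegral.integral_of_le hc, integral_rpow (Or.inl (by linarith)),
    sub_add_cancel, Real.zero_rpow hδ.ne', sub_zero]
  filter_upwards [ae_restrict_mem measurableSet_Ioc] with α hα
  exact Real.rpow_nonneg hα.1.le _

/-- The normalised Laplace–Carleson embedding for `1 < p < 2`. -/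
lemma lintegral_laplace_rpow_le_of_lt_two {ι : Type*} [Countable ι] [MeasurableSpace ι]
    [DiscreteMeasurableSpace ι] {ν : Measure ι} {ζ : ι → ℂ} (hζ : ∀ k, 0 < (ζ k).re) {K : ℝ≥0∞}
    {s : ℝ} (hs : 1 ≤ s) (hC : IsCarlesonFamily ν ζ K s) {p δ : ℝ} (hp1 : 1 < p) (hp2 : p < 2)
    (hδ : δ * (p - 1) = 2 - p) {u : ℝ → ℂ} (hum : Measurable u)
    (hu : IntegrableOn u (Ioi 0)) (hup : ∫⁻ t in Ioi 0, ‖u t‖ₑ ^ p = 1) :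
    ∫⁻ k, ENNReal.ofReal (‖laplace u (ζ k)‖ ^ (s * (δ + 2))) ∂ν ≤
      ENNReal.ofReal (s * (δ + 2)) *
        ((ENNReal.ofReal (2 * s) * (K * 80 ^ s) * 32 ^ s * ENNReal.ofReal (2 * Real.pi) ^ s *
          ENNReal.ofReal (2 ^ (2 * s))) * ENNReal.ofReal (2 ^ δ) ^ (s - 1) *
          ENNReal.ofReal (2 ^ δ / δ)) := by
  have hp0 : 0 < p - 1 := by linarith
  have hδ0 : 0 < δ := pos_of_mul_pos_left (by rw [hδ]; linarith) hp0.le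
  set C₂ := ENNReal.ofReal (2 * s) * (K * 80 ^ s) * 32 ^ s * ENNReal.ofReal (2 * Real.pi) ^ s
  -- The cut height is tuned so that `γ^{p-1} = 2/α`: since `‖u‖_p = 1`, the part of `u` above `γ α`
  -- has `L¹` norm at most `α/2`. Here `δ = (2 - p)/(p - 1)`, so that `δ + 2 = p'` and `γ^{2-p} =
  -- 2^δ α^{-δ}`.
  set γ : ℝ → ℝ := fun α => (α / 2) ^ (-(1 / (p - 1))) with hγ
  have hγ0 : ∀ α, 0 < α → 0 < γ α := fun α hα => Real.rpow_pos_of_pos (half_pos hα) _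
  have hγpow : ∀ α, 0 < α → γ α ^ (p - 1) = (α / 2)⁻¹ := fun α hα => by
    rw [hγ]
    simp only
    rw [← Real.rpow_mul (half_pos hα).le, neg_mul, one_div_mul_cancel hp0.ne', Real.rpow_neg_one]
  have hγpow2 : ∀ α, 0 < α → γ α ^ (2 - p) = 2 ^ δ * α ^ (-δ) := fun α hα => by
    rw [hγ]
    simp only
    rw [← Real.rpow_mul (half_pos hα).le, ← hδ, neg_mul, one_div_mul_eq_div,
      mul_div_cancel_right₀ _ hp0.ne', Real.div_rpow hα.le zero_le_two, Real.rpow_neg zero_le_two,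
      div_inv_eq_mul, mul_comm]
  have hlow : ∀ α, MeasurableSet {t | ‖u t‖ ≤ γ α} := fun α =>
    measurableSet_le hum.norm measurable_const
  set N : ℝ → ℝ≥0∞ := fun α => ∫⁻ t in Ioi 0, ‖{t | ‖u t‖ ≤ γ α}.indicator u t‖ₑ ^ 2
  have hγm : Measurable γ := by fun_prop
  have hG : Measurable fun x : ℝ × ℝ => ‖{t | ‖u t‖ ≤ γ x.1}.indicator u x.2‖ₑ ^ 2 := by
    have h : Measurable ({x : ℝ × ℝ | ‖u x.2‖ ≤ γ x.1}.indicator fun x => u x.2) :=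
      Measurable.indicator (by fun_prop) (measurableSet_le (by fun_prop) (by fun_prop))
    exact h.enorm.pow_const 2
  have hNm : Measurable N := hG.lintegral_prod_right'
  -- Below the cut, `|u|² ≤ γ^{2-p} |u|^p`.
  have hN : ∀ α : ℝ, 0 < α → N α ≤ ENNReal.ofReal (2 ^ δ) * ENNReal.ofReal (α ^ (-δ)) := by
    intro α hα
    rw [← ENNReal.ofReal_mul (by positivity), ← hγpow2 α hα,
      ← mul_one (ENNReal.ofReal (γ α ^ (2 - p))), ← hup, ← lintegral_const_mul _ (by fun_prop)]
    refine lintegral_mono fun t => ?_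
    by_cases ht : ‖u t‖ ≤ γ α
    · rw [indicator_of_mem (show t ∈ {t | ‖u t‖ ≤ γ α} from ht), ← ofReal_norm,
        ENNReal.ofReal_rpow_of_nonneg (norm_nonneg _) (by linarith),
        ← ENNReal.ofReal_mul (Real.rpow_nonneg (hγ0 α hα).le _),
        ← ENNReal.ofReal_pow (norm_nonneg _)]
      refine ENNReal.ofReal_le_ofReal ?_
      have : ‖u t‖ ^ 2 = ‖u t‖ ^ (2 - p) * ‖u t‖ ^ p := by
        rw [← Real.rpow_add_of_nonneg (norm_nonneg _) (by linarith) (by linarith), sub_add_cancel,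
          Real.rpow_two]
      rw [this]
      exact mul_le_mul_of_nonneg_right (Real.rpow_le_rpow (norm_nonneg _) ht (by linarith))
        (by positivity)
    · rw [indicator_of_notMem (show t ∉ {t | ‖u t‖ ≤ γ α} from ht)]
      simp
  have hD : ∀ α : ℝ, 0 < α → ν {k | α < ‖laplace u (ζ k)‖} ≤
      C₂ * ENNReal.ofReal (2 ^ (2 * s)) * ENNReal.ofReal (α ^ (-(2 * s))) * N α ^ s := by
    intro α hα
    set v := {t | ‖u t‖ ≤ γ α}.indicator u with hv
    set w := {t | ‖u t‖ ≤ γ α}ᶜ.indicator u with hw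
    have hvw : u = v + w := (indicator_self_add_compl _ _).symm
    have hvi : IntegrableOn v (Ioi 0) := hu.indicator (hlow α)
    have hwi : IntegrableOn w (Ioi 0) := hu.indicator (hlow α).compl
    have hv2 : MemLp v 2 (volume.restrict (Ioi 0)) := by
      rw [memLp_two_iff_integrable_sq_norm hvi.1]
      simp_rw [sq]
      refine hvi.norm.bdd_mul (c := γ α) hvi.1.norm (Eventually.of_forall fun t => ?_)
      by_cases ht : ‖u t‖ ≤ γ α <;> simp [hv, ht, (hγ0 α hα).le]
    -- Above the cut, `|u| ≤ (α/2) |u|^p`, because `|u|^{p-1} ≥ γ^{p-1} = (α/2)⁻¹`.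
    have hwb : ∀ k, ‖laplace w (ζ k)‖ ≤ α / 2 := by
      intro k
      have h : ‖laplace w (ζ k)‖ₑ ≤ ENNReal.ofReal (α / 2) := by
        refine (enorm_laplace_le_lintegral (hζ k).le).trans ?_
        rw [← mul_one (ENNReal.ofReal (α / 2)), ← hup, ← lintegral_const_mul _ (by fun_prop)]
        refine lintegral_mono fun t => ?_
        by_cases ht : ‖u t‖ ≤ γ α
        · simp [hw, ht]
        · rw [hw, indicator_of_mem (show t ∈ {t | ‖u t‖ ≤ γ α}ᶜ from ht), ← ofReal_norm,
            ENNReal.ofReal_rpow_of_nonneg (norm_nonneg _) (by linarith),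
            ← ENNReal.ofReal_mul (half_pos hα).le]
          refine ENNReal.ofReal_le_ofReal ?_
          have h0 : 0 < ‖u t‖ := (hγ0 α hα).trans (not_le.1 ht)
          have h1 : (α / 2)⁻¹ ≤ ‖u t‖ ^ (p - 1) := by
            rw [← hγpow α hα]
            exact Real.rpow_le_rpow (hγ0 α hα).le (not_le.1 ht).le hp0.le
          have h2 : ‖u t‖ ^ p = ‖u t‖ ^ (p - 1) * ‖u t‖ := by
            rw [← Real.rpow_add_one h0.ne', sub_add_cancel]
          rw [h2, ← mul_assoc]
          refine le_mul_of_one_le_left h0.le ?_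
          rwa [inv_le_iff_one_le_mul₀' (half_pos hα)] at h1
      rw [← ofReal_norm] at h
      exact (ENNReal.ofReal_le_ofReal_iff (half_pos hα).le).1 h
    -- The upper part contributes at most `α/2`, so the lower part must contribute at least `α/2`;
    -- Chebyshev and the `L²` embedding then finish.
    have hsub : {k | α < ‖laplace u (ζ k)‖} ⊆ {k | ENNReal.ofReal ((α / 2) ^ (2 * s)) ≤
        ENNReal.ofReal (‖laplace v (ζ k)‖ ^ (2 * s))} := by
      intro k (hk : α < _)
      refine ENNReal.ofReal_le_ofReal (Real.rpow_le_rpow (half_pos hα).le ?_ (by linarith))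
      rw [hvw, laplace_add hvi hwi (hζ k).le] at hk
      linarith [norm_add_le (laplace v (ζ k)) (laplace w (ζ k)), hwb k]
    have hpos : 0 < (α / 2) ^ (2 * s) := Real.rpow_pos_of_pos (half_pos hα) _
    refine (measure_mono hsub).trans ((meas_ge_le_lintegral_div
      (Measurable.of_discrete).aemeasurable (by simpa using hpos) ENNReal.ofReal_ne_top).trans ?_)
    refine (ENNReal.div_le_div_right (lintegral_laplace_rpow_le_two hζ hs hC hvi hv2) _).trans_eq ?_
    change C₂ * N α ^ s / _ = _
    rw [div_eq_mul_inv, ← ENNReal.ofReal_inv_of_pos hpos, Real.div_rpow hα.le zero_le_two, inv_div,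
      div_eq_mul_inv, ENNReal.ofReal_mul (by positivity), Real.rpow_neg hα.le]
    ring
  have hW : ∫⁻ α in Ioi (0 : ℝ), N α * ENNReal.ofReal (α ^ (δ - 1)) ≤
      ENNReal.ofReal (2 ^ δ / δ) := by
    have h : ∀ α, N α * ENNReal.ofReal (α ^ (δ - 1)) = ∫⁻ t in Ioi 0,
        ‖{t | ‖u t‖ ≤ γ α}.indicator u t‖ₑ ^ 2 * ENNReal.ofReal (α ^ (δ - 1)) := fun α =>
      (lintegral_mul_const _ ((hum.indicator (hlow α)).enorm.pow_const 2)).symm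
    simp_rw [h]
    rw [lintegral_lintegral_swap (hG.mul (by fun_prop)).aemeasurable,
      ← mul_one (ENNReal.ofReal (2 ^ δ / δ)), ← hup, ← lintegral_const_mul _ (by fun_prop)]
    refine lintegral_mono fun t => ?_
    rcases (norm_nonneg (u t)).eq_or_lt with h0 | h0
    · have hu0 : u t = 0 := norm_eq_zero.1 h0.symm
      have : ∀ α, {t | ‖u t‖ ≤ γ α}.indicator u t = 0 := fun α =>
        indicator_apply_eq_zero.2 fun _ => hu0
      simp [this]
    -- Since `γ` decreases, `|u(t)| ≤ γ α` forces `α ≤ c`. Integrating `α^{δ-1}` up to `c` gives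
    -- `c^δ/δ = (2^δ/δ) |u(t)|^{p-2}`, turning `|u|²` into `|u|^p`.
    set c := 2 * ‖u t‖ ^ (-(p - 1)) with hc
    have hc0 : 0 < c := by positivity
    calc ∫⁻ α in Ioi (0 : ℝ),
          ‖{t | ‖u t‖ ≤ γ α}.indicator u t‖ₑ ^ 2 * ENNReal.ofReal (α ^ (δ - 1))
        ≤ ∫⁻ α in Ioi (0 : ℝ), (Ioc 0 c).indicator
            (fun α => ‖u t‖ₑ ^ 2 * ENNReal.ofReal (α ^ (δ - 1))) α := by
          refine setLIntegral_mono' measurableSet_Ioi fun α (hα : 0 < α) => ?_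
          by_cases ht : ‖u t‖ ≤ γ α
          · have hαc : α ≤ c := by
              have h1 := Real.rpow_le_rpow h0.le ht hp0.le
              rw [hγpow α hα, le_inv_comm₀ (by positivity) (half_pos hα),
                ← Real.rpow_neg h0.le] at h1
              rw [hc]
              linarith
            rw [indicator_of_mem (show α ∈ Ioc 0 c from ⟨hα, hαc⟩),
              indicator_of_mem (show t ∈ {t | ‖u t‖ ≤ γ α} from ht)]
          · rw [indicator_of_notMem (show t ∉ {t | ‖u t‖ ≤ γ α} from ht)]
            simp
      _ ≤ ∫⁻ α in Ioc 0 c, ‖u t‖ₑ ^ 2 * ENNReal.ofReal (α ^ (δ - 1)) := by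
          rw [← lintegral_indicator measurableSet_Ioc]
          exact setLIntegral_le_lintegral _ _
      _ = ENNReal.ofReal (2 ^ δ / δ) * ‖u t‖ₑ ^ p := by
          rw [lintegral_const_mul _ (by fun_prop), lintegral_rpow_Ioc hc0.le hδ0, ← ofReal_norm,
            ENNReal.ofReal_rpow_of_nonneg h0.le (by linarith), ← ENNReal.ofReal_pow h0.le,
            ← ENNReal.ofReal_mul (by positivity), ← ENNReal.ofReal_mul (by positivity)]
          congr 1
          have h1 : c ^ δ = 2 ^ δ * ‖u t‖ ^ (-(2 - p)) := by
            rw [hc, Real.mul_rpow zero_le_two (by positivity), ← Real.rpow_mul h0.le, ← hδ]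
            ring_nf
          have h2 : ‖u t‖ ^ p = ‖u t‖ ^ 2 * ‖u t‖ ^ (-(2 - p)) := by
            rw [← Real.rpow_two, ← Real.rpow_add h0]
            ring_nf
          rw [h1, h2]
          ring
  refine (lintegral_rpow_le_of_measure_lt_le (fun k => norm_nonneg _) Measurable.of_discrete
    (by positivity : 0 < s * (δ + 2)) hs
    (by ring : s * (δ + 2) - 1 + -(2 * s) + -δ * (s - 1) = δ - 1) hN hD hNm).trans ?_
  gcongr

/-- The normalised Laplace–Carleson embedding for `1 < p ≤ 2`. -/
lemma exists_lintegral_laplace_rpow_le_of_eq_one {ι : Type*} [Countable ι] [MeasurableSpace ι]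
    [DiscreteMeasurableSpace ι] {ν : Measure ι} {ζ : ι → ℂ} (hζ : ∀ k, 0 < (ζ k).re) {K : ℝ≥0∞}
    (hK : K ≠ ∞) {s : ℝ} (hs : 1 ≤ s) (hC : IsCarlesonFamily ν ζ K s) {p : ℝ} (hp1 : 1 < p)
    (hp2 : p ≤ 2) : ∃ C : ℝ≥0∞, C ≠ ∞ ∧ ∀ u : ℝ → ℂ, Measurable u → IntegrableOn u (Ioi 0) →
      ∫⁻ t in Ioi 0, ‖u t‖ₑ ^ p = 1 →
      ∫⁻ k, ENNReal.ofReal (‖laplace u (ζ k)‖ ^ (s * (p / (p - 1)))) ∂ν ≤ C := by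
  have hs0 : 0 ≤ s := by linarith
  have hp0 : 0 < p - 1 := by linarith
  have hpow : ∀ x : ℝ≥0∞, x ≠ ∞ → x ^ s ≠ ∞ := fun x hx => ENNReal.rpow_ne_top_of_nonneg hs0 hx
  rcases hp2.lt_or_eq with hp2 | rfl
  · have e : p / (p - 1) = (2 - p) / (p - 1) + 2 := by field_simp; ring
    refine ⟨_, ?_, fun u hum hu hup => by
      rw [e]
      exact lintegral_laplace_rpow_le_of_lt_two hζ hs hC hp1 hp2
        (div_mul_cancel₀ _ hp0.ne') hum hu hup⟩
    refine ENNReal.mul_ne_top ENNReal.ofReal_ne_top (ENNReal.mul_ne_top (ENNReal.mul_ne_top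
      (ENNReal.mul_ne_top (ENNReal.mul_ne_top (ENNReal.mul_ne_top (ENNReal.mul_ne_top
        ENNReal.ofReal_ne_top (ENNReal.mul_ne_top hK (hpow _ (by simp)))) (hpow _ (by simp)))
        (hpow _ ENNReal.ofReal_ne_top)) ENNReal.ofReal_ne_top)
      (ENNReal.rpow_ne_top_of_nonneg (by linarith) ENNReal.ofReal_ne_top)) ENNReal.ofReal_ne_top)
  · refine ⟨ENNReal.ofReal (2 * s) * (K * 80 ^ s) * 32 ^ s * ENNReal.ofReal (2 * Real.pi) ^ s,
      ENNReal.mul_ne_top (ENNReal.mul_ne_top (ENNReal.mul_ne_top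
        ENNReal.ofReal_ne_top (ENNReal.mul_ne_top hK (hpow _ (by simp)))) (hpow _ (by simp)))
        (hpow _ ENNReal.ofReal_ne_top), fun u hum hu hup => ?_⟩
    simp only [ENNReal.rpow_ofNat] at hup
    have hu2 : MemLp u 2 (volume.restrict (Ioi 0)) := by
      refine ⟨hum.aestronglyMeasurable, ?_⟩
      have := eLpNorm_nnreal_pow_eq_lintegral (f := u) (μ := volume.restrict (Ioi 0)) (p := 2)
        two_ne_zero
      simp only [NNReal.coe_ofNat, ENNReal.rpow_ofNat, ENNReal.coe_ofNat, hup] at this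
      by_contra hcon
      rw [not_lt_top_iff.1 hcon] at this
      simp at this
    have h := lintegral_laplace_rpow_le_two hζ hs hC hu hu2
    rw [hup, ENNReal.one_rpow, mul_one] at h
    rwa [show s * (2 / (2 - 1)) = 2 * s by ring]

lemma laplace_congr_ae {u v : ℝ → ℂ} (h : u =ᵐ[volume.restrict (Ioi 0)] v) (z : ℂ) :
    laplace u z = laplace v z := by
  refine integral_congr_ae ?_
  filter_upwards [h] with t ht
  rw [ht]

lemma laplace_const_mul (c : ℂ) (u : ℝ → ℂ) (z : ℂ) :
    laplace (fun t => c * u t) z = c * laplace u z := by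
  rw [laplace, laplace, ← integral_const_mul]
  congr with t
  ring

/-- The Laplace–Carleson embedding for integrable functions. -/
lemma exists_lintegral_laplace_rpow_le_of_integrable {ι : Type*} [Countable ι] [MeasurableSpace ι]
    [DiscreteMeasurableSpace ι] {ν : Measure ι} {ζ : ι → ℂ} (hζ : ∀ k, 0 < (ζ k).re) {K : ℝ≥0∞}
    (hK : K ≠ ∞) {s : ℝ} (hs : 1 ≤ s) (hC : IsCarlesonFamily ν ζ K s) {p : ℝ} (hp1 : 1 < p)
    (hp2 : p ≤ 2) : ∃ C : ℝ≥0∞, C ≠ ∞ ∧ ∀ u : ℝ → ℂ, Measurable u → IntegrableOn u (Ioi 0) →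
      ∫⁻ t in Ioi 0, ‖u t‖ₑ ^ p ≠ ∞ →
      ∫⁻ k, ENNReal.ofReal (‖laplace u (ζ k)‖ ^ (s * (p / (p - 1)))) ∂ν ≤
        C * (∫⁻ t in Ioi 0, ‖u t‖ₑ ^ p) ^ (s * (p / (p - 1)) / p) := by
  obtain ⟨C, hC', h⟩ := exists_lintegral_laplace_rpow_le_of_eq_one hζ hK hs hC hp1 hp2
  refine ⟨C, hC', fun u hum hu hA => ?_⟩
  set q := s * (p / (p - 1))
  have hq : 0 < q := mul_pos (by linarith) (div_pos (by linarith) (by linarith))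
  have hp : 0 < p := by linarith
  set A := ∫⁻ t in Ioi 0, ‖u t‖ₑ ^ p with hAdef
  -- A null input cannot be normalised; its Laplace transform vanishes.
  rcases eq_or_ne A 0 with hA0 | hA0
  · have h0 : u =ᵐ[volume.restrict (Ioi 0)] fun _ => 0 := by
      rw [hAdef, lintegral_eq_zero_iff (by fun_prop)] at hA0
      filter_upwards [hA0] with t ht
      simpa [hp, hp.le, ENNReal.rpow_eq_zero_iff, not_lt.2 hp.le] using ht
    have h1 : ∀ z, laplace u z = 0 := fun z => by
      rw [laplace_congr_ae h0]
      simp [laplace]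
    simp [h1, Real.zero_rpow hq.ne']
  set a := A.toReal ^ (1 / p)
  have hApos : 0 < A.toReal := ENNReal.toReal_pos hA0 hA
  have ha : 0 < a := Real.rpow_pos_of_pos hApos _
  have hap : ENNReal.ofReal (a⁻¹ ^ p) = A⁻¹ := by
    rw [Real.inv_rpow ha.le, ← Real.rpow_mul hApos.le, one_div_mul_cancel hp.ne', Real.rpow_one,
      ENNReal.ofReal_inv_of_pos hApos, ENNReal.ofReal_toReal hA]
  have hv := h (fun t => (a⁻¹ : ℝ) * u t) (by fun_prop) (hu.const_mul _) (by
    have e : ∀ t, ‖((a⁻¹ : ℝ) : ℂ) * u t‖ₑ ^ p = A⁻¹ * ‖u t‖ₑ ^ p := fun t => by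
      rw [enorm_mul, ENNReal.mul_rpow_of_nonneg _ _ hp.le, ← hap, ← ofReal_norm (((a⁻¹ : ℝ) : ℂ)),
        Complex.norm_real, Real.norm_of_nonneg (by positivity),
        ENNReal.ofReal_rpow_of_nonneg (by positivity) hp.le]
    simp_rw [e]
    rw [lintegral_const_mul _ (by fun_prop), ENNReal.inv_mul_cancel hA0 hA])
  have e : ∀ k, ENNReal.ofReal (‖laplace u (ζ k)‖ ^ q) = ENNReal.ofReal (a ^ q) *
      ENNReal.ofReal (‖laplace (fun t => (a⁻¹ : ℝ) * u t) (ζ k)‖ ^ q) := fun k => by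
    rw [laplace_const_mul, norm_mul, Complex.norm_real, Real.norm_of_nonneg (by positivity),
      ← ENNReal.ofReal_mul (by positivity), ← Real.mul_rpow ha.le (by positivity),
      mul_inv_cancel_left₀ ha.ne']
  simp_rw [e]
  rw [lintegral_const_mul _ Measurable.of_discrete, mul_comm]
  refine (mul_le_mul_left hv _).trans_eq ?_
  congr 1
  rw [← Real.rpow_mul hApos.le, ENNReal.toReal_rpow, ENNReal.ofReal_toReal
    (ENNReal.rpow_ne_top_of_nonneg (by positivity) hA), one_div_mul_eq_div]

lemma memLp_exp_neg_mul {z : ℂ} (hz : 0 < z.re) {p : ℝ≥0∞} (hp0 : p ≠ 0) (hp : p ≠ ∞) :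
    MemLp (fun t : ℝ => Complex.exp (-(z * t))) p (volume.restrict (Ioi 0)) := by
  have hp' := ENNReal.toReal_pos hp0 hp
  rw [← integrable_norm_rpow_iff (Continuous.aestronglyMeasurable (by fun_prop)) hp0 hp]
  refine (integrableOn_exp_mul_Ioi (a := -(z.re * p.toReal)) (by nlinarith) 0).congr
    (Eventually.of_forall fun t => ?_)
  simp only [Complex.norm_exp, ← Real.exp_mul]
  simp
  ring

lemma integrableOn_exp_neg_mul_of_memLp {z : ℂ} (hz : 0 < z.re) {p p' : ℝ≥0∞}
    (hpp' : p.HolderConjugate p') (hp' : p' ≠ ∞) {u : ℝ → ℂ}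
    (hu : MemLp u p (volume.restrict (Ioi 0))) :
    IntegrableOn (fun t : ℝ => Complex.exp (-(z * t)) * u t) (Ioi 0) := by
  have : p'.HolderConjugate p := hpp'.symm
  have hp0 : p' ≠ 0 := ENNReal.HolderConjugate.ne_zero p' p
  exact memLp_one_iff_integrable.1 (hu.mul (r := 1) (memLp_exp_neg_mul hz hp0 hp'))

/-- The **Laplace–Carleson embedding**: if the points `ζ` with masses `ν` form an `s`-Carleson
family, then the Laplace transform maps `L^p(0, ∞)`, `1 < p ≤ 2`, boundedly to `L^{sp'}(ν)`. -/
lemma exists_lintegral_laplace_rpow_le {ι : Type*} [Countable ι] [MeasurableSpace ι]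
    [DiscreteMeasurableSpace ι] {ν : Measure ι} {ζ : ι → ℂ} (hζ : ∀ k, 0 < (ζ k).re) {K : ℝ≥0∞}
    (hK : K ≠ ∞) {s : ℝ} (hs : 1 ≤ s) (hC : IsCarlesonFamily ν ζ K s) {p p' : ℝ≥0∞}
    (hpp' : p.HolderConjugate p') (hp1 : 1 < p) (hp2 : p ≤ 2) :
    ∃ C : ℝ≥0∞, C ≠ ∞ ∧ ∀ u : ℝ → ℂ, MemLp u p (volume.restrict (Ioi 0)) →
      ∫⁻ k, ENNReal.ofReal (‖laplace u (ζ k)‖ ^ (s * p'.toReal)) ∂ν ≤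
        C * eLpNorm u p (volume.restrict (Ioi 0)) ^ (s * p'.toReal) := by
  have hptop : p ≠ ∞ := (hp2.trans_lt (by simp)).ne
  have hp'top : p' ≠ ∞ := by
    rintro rfl
    exact hp1.ne' ((ENNReal.HolderConjugate.eq_top_iff_eq_one ∞ p).1 rfl)
  have hp1r : 1 < p.toReal := by
    rw [← ENNReal.toReal_one]; exact (ENNReal.toReal_lt_toReal (by simp) hptop).2 hp1
  have hp2r : p.toReal ≤ 2 := ENNReal.toReal_le_of_le_ofReal zero_le_two (by simpa using hp2)
  have hp0 : p ≠ 0 := (zero_lt_one.trans hp1).ne'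
  have hconj : p.toReal.HolderConjugate p'.toReal :=
    ENNReal.HolderConjugate.toReal_of_ne_top hptop hp'top
  obtain ⟨C, hCtop, h⟩ := exists_lintegral_laplace_rpow_le_of_integrable hζ hK hs hC hp1r hp2r
  rw [← hconj.conjugate_eq] at h
  refine ⟨C, hCtop, fun u hu => ?_⟩
  set q := s * p'.toReal
  have hq : 0 ≤ q := by positivity
  have hnorm : ∀ v : ℝ → ℂ, (∫⁻ t in Ioi 0, ‖v t‖ₑ ^ p.toReal) ^ (q / p.toReal) =
      eLpNorm v p (volume.restrict (Ioi 0)) ^ q := fun v => by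
    rw [eLpNorm_eq_lintegral_rpow_enorm_toReal hp0 hptop, ← ENNReal.rpow_mul, one_div_mul_eq_div]
  wlog hum : Measurable u generalizing u
  · have hae := hu.1.aemeasurable.ae_eq_mk
    have := this _ (hu.ae_eq hae) hu.1.aemeasurable.measurable_mk
    rw [← eLpNorm_congr_ae hae] at this
    simpa only [← laplace_congr_ae hae] using this
  -- Cutting off to `(0, n]` makes `u` integrable by finiteness of the measure. The Laplace
  -- transforms converge pointwise by dominated convergence, and Fatou's lemma passes the uniform
  -- bound to the limit.
  set w : ℕ → ℝ → ℂ := fun n => (Iic (n : ℝ)).indicator u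
  have hwm : ∀ n, Measurable (w n) := fun n => hum.indicator measurableSet_Iic
  have hwp : ∀ n, MemLp (w n) p (volume.restrict (Ioi 0)) := fun n => hu.indicator measurableSet_Iic
  have hwi : ∀ n, IntegrableOn (w n) (Ioi 0) := fun n => by
    have h1 : MemLp u p ((volume.restrict (Ioi 0)).restrict (Iic (n : ℝ))) := hu.restrict _
    have : IsFiniteMeasure ((volume.restrict (Ioi (0 : ℝ))).restrict (Iic (n : ℝ))) := by
      rw [Measure.restrict_restrict measurableSet_Iic, Iic_inter_Ioi]
      infer_instance
    exact (integrable_indicator_iff measurableSet_Iic).2 (h1.integrable hp1.le)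
  have hle : ∀ n, ∫⁻ k, ENNReal.ofReal (‖laplace (w n) (ζ k)‖ ^ q) ∂ν ≤
      C * eLpNorm u p (volume.restrict (Ioi 0)) ^ q := fun n => by
    refine (h (w n) (hwm n) (hwi n) ?_).trans ?_
    · have h1 := (hwp n).2.ne
      have := lintegral_rpow_enorm_lt_top_of_eLpNorm_lt_top hp0 hptop (hwp n).2
      exact this.ne
    · rw [hnorm]
      gcongr
      exact eLpNorm_indicator_le u
  have hlim : ∀ k, Tendsto (fun n => ENNReal.ofReal (‖laplace (w n) (ζ k)‖ ^ q)) atTop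
      (𝓝 (ENNReal.ofReal (‖laplace u (ζ k)‖ ^ q))) := fun k => by
    refine ENNReal.tendsto_ofReal (Tendsto.rpow_const (Tendsto.norm ?_) (Or.inr hq))
    have hi := integrableOn_exp_neg_mul_of_memLp (hζ k) hpp' hp'top hu
    refine tendsto_integral_of_dominated_convergence _
      (fun n => (Continuous.aestronglyMeasurable (by fun_prop)).mul (hwi n).1) hi.norm
      (fun n => Eventually.of_forall fun t => ?_) (Eventually.of_forall fun t => ?_)
    · rw [norm_mul, norm_mul]
      gcongr
      exact norm_indicator_le_norm_self _ _
    · obtain ⟨N, hN⟩ := exists_nat_ge t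
      refine tendsto_const_nhds.congr' ?_
      filter_upwards [eventually_ge_atTop N] with n hn
      have : t ∈ Iic (n : ℝ) := hN.trans (by exact_mod_cast hn)
      simp [w, indicator_of_mem this]
  calc ∫⁻ k, ENNReal.ofReal (‖laplace u (ζ k)‖ ^ q) ∂ν
      = ∫⁻ k, liminf (fun n => ENNReal.ofReal (‖laplace (w n) (ζ k)‖ ^ q)) atTop ∂ν :=
        lintegral_congr fun k => (hlim k).liminf_eq.symm
    _ ≤ liminf (fun n => ∫⁻ k, ENNReal.ofReal (‖laplace (w n) (ζ k)‖ ^ q) ∂ν) atTop :=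
        lintegral_liminf_le fun n => Measurable.of_discrete
    _ ≤ _ := liminf_le_of_le (by isBoundedDefault) fun b hb => by
        obtain ⟨n, hn⟩ := hb.exists
        exact hn.trans (hle n)

/-! ### The point measure on the index set -/

/-- The weights `‖b_k‖^q` as a measure on the indices. -/
noncomputable def weightMeasure (q : ℝ≥0∞) (b : ℕ → ℂ) : Measure ℕ :=
  Measure.sum fun k => ENNReal.ofReal (‖b k‖ ^ q.toReal) • Measure.dirac k

lemma pointMeasure_apply (q : ℝ≥0∞) (lam b : ℕ → ℂ) (S : Set ℂ) :
    pointMeasure q lam b S =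
      ∑' k, ENNReal.ofReal (‖b k‖ ^ q.toReal) * S.indicator 1 (-lam k) := by
  simp [pointMeasure, Measure.sum_apply_of_countable]

/-- Transfers the Carleson condition from `ℂ` to the index set, where every function is measurable
and repeated eigenvalues need no care. -/
lemma weightMeasure_preimage (q : ℝ≥0∞) (lam b : ℕ → ℂ) (S : Set ℂ) :
    weightMeasure q b {k | -lam k ∈ S} = pointMeasure q lam b S := by
  rw [pointMeasure_apply]
  simp only [weightMeasure, Measure.sum_apply_of_countable, Measure.smul_apply,
    Measure.dirac_apply, smul_eq_mul]
  rfl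

lemma lintegral_weightMeasure (q : ℝ≥0∞) (b : ℕ → ℂ) (f : ℕ → ℝ≥0∞) :
    ∫⁻ k, f k ∂weightMeasure q b = ∑' k, ENNReal.ofReal (‖b k‖ ^ q.toReal) * f k := by
  simp [weightMeasure]

/-- The closed box of size `r` lies in the open-sided square over the interval of radius `r`, whose
length is `2r`; hence the factor `2 ^ s`. -/
lemma isCarlesonFamily_of_carlesonSquare {q : ℝ≥0∞} {lam b : ℕ → ℂ} {κ s : ℝ} (hs : 0 ≤ s)
    (h : ∀ I : Set ℝ, I.OrdConnected →
      pointMeasure q lam b (carlesonSquare I) ≤ ENNReal.ofReal κ * volume I ^ s)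
    (hlam : ∀ k, (lam k).re < 0) :
    IsCarlesonFamily (weightMeasure q b) (fun k => -lam k) (ENNReal.ofReal κ * 2 ^ s) s := by
  intro y r hr
  have hI : (Metric.closedBall y r).OrdConnected := by
    rw [Real.closedBall_eq_Icc]; exact ordConnected_Icc
  have hsub : {k | |(-lam k).im - y| ≤ r ∧ (-lam k).re ≤ r} ⊆
      {k | -lam k ∈ carlesonSquare (Metric.closedBall y r)} := by
    rintro k ⟨h1, h2⟩
    refine ⟨by rwa [Metric.mem_closedBall, Real.dist_eq], ?_, ?_⟩
    · simpa using hlam k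
    · rw [Real.volume_closedBall]
      exact (ENNReal.ofReal_lt_ofReal_iff (by positivity)).2 (by linarith)
  refine (measure_mono hsub).trans ?_
  rw [weightMeasure_preimage]
  refine (h _ hI).trans_eq ?_
  rw [Real.volume_closedBall, ENNReal.ofReal_mul zero_le_two, ENNReal.mul_rpow_of_nonneg _ _ hs,
    ENNReal.ofReal_ofNat, mul_assoc]

/-- Under the Carleson condition, `u ↦ (b_k û(-lam_k))` is bounded from `L^p(0, ∞)` to `ℓ^q`. -/
lemma exists_seq_laplace {p p' q : ℝ≥0∞} [Fact (1 ≤ q)] (hpp' : p.HolderConjugate p')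
    (hp1 : 1 < p) (hp : p ≤ 2) (hp'0 : 0 < p'.toReal) (hp'q : p'.toReal ≤ q.toReal)
    {lam b : ℕ → ℂ} (hlam : ∀ k, (lam k).re < 0) {κ : ℝ}
    (h : ∀ I : Set ℝ, I.OrdConnected → pointMeasure q lam b (carlesonSquare I) ≤
      ENNReal.ofReal κ * volume I ^ (q.toReal / p'.toReal)) :
    ∃ m : ℝ, 0 < m ∧ ∀ u : ℝ → ℂ, MemLp u p (volume.restrict (Ioi 0)) →
      ∃ x : Seq q, (∀ k, x k = b k * laplace u (-lam k)) ∧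
        ‖x‖ ≤ m * (eLpNorm u p (volume.restrict (Ioi 0))).toReal := by
  have hs : 1 ≤ q.toReal / p'.toReal := (one_le_div hp'0).2 hp'q
  have hq0 : 0 < q.toReal := hp'0.trans_le hp'q
  have hs0 : 0 ≤ q.toReal / p'.toReal := by linarith
  obtain ⟨C, hC, hbound⟩ := exists_lintegral_laplace_rpow_le (ν := weightMeasure q b)
    (ζ := fun k => -lam k) (fun k => by simpa using hlam k)
    (ENNReal.mul_ne_top ENNReal.ofReal_ne_top (ENNReal.rpow_ne_top_of_nonneg hs0 (by simp)))
    hs (isCarlesonFamily_of_carlesonSquare hs0 h hlam) hpp' hp1 hp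
  rw [div_mul_cancel₀ _ hp'0.ne'] at hbound
  -- The summand `1` only ensures that the constant is positive.
  refine ⟨C.toReal ^ (1 / q.toReal) + 1, by positivity, fun u hu => ?_⟩
  set E := eLpNorm u p (volume.restrict (Ioi 0))
  have hE : E ≠ ∞ := hu.2.ne
  have hsum : ∑' k, ENNReal.ofReal (‖b k * laplace u (-lam k)‖ ^ q.toReal) ≤
      C * E ^ q.toReal := by
    refine le_trans (le_of_eq ?_) (hbound u hu)
    rw [lintegral_weightMeasure]
    congr with k
    rw [← ENNReal.ofReal_mul (by positivity), norm_mul,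
      Real.mul_rpow (norm_nonneg _) (norm_nonneg _)]
  have htop : C * E ^ q.toReal ≠ ∞ :=
    ENNReal.mul_ne_top hC (ENNReal.rpow_ne_top_of_nonneg hq0.le hE)
  have hsummable : Summable fun k => ‖b k * laplace u (-lam k)‖ ^ q.toReal := by
    have := ENNReal.summable_toReal (ne_top_of_le_ne_top htop hsum)
    refine this.congr fun k => ENNReal.toReal_ofReal (by positivity)
  let x : Seq q := ⟨fun k => b k * laplace u (-lam k), memℓp_gen hsummable⟩
  refine ⟨x, fun k => rfl, ?_⟩
  have hx : ‖x‖ ^ q.toReal ≤ C.toReal * E.toReal ^ q.toReal := by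
    rw [lp.norm_rpow_eq_tsum hq0]
    change ∑' k, ‖b k * laplace u (-lam k)‖ ^ q.toReal ≤ _
    rw [← ENNReal.ofReal_tsum_of_nonneg (fun k => by positivity) hsummable,
      ENNReal.ofReal_le_iff_le_toReal htop, ENNReal.toReal_mul, ← ENNReal.toReal_rpow] at hsum
    exact hsum
  have hx2 : ‖x‖ ≤ C.toReal ^ (1 / q.toReal) * E.toReal := by
    have h1 := Real.rpow_le_rpow (by positivity) hx (by positivity : 0 ≤ 1 / q.toReal)
    rwa [← Real.rpow_mul (norm_nonneg _), mul_one_div_cancel hq0.ne', Real.rpow_one,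
      Real.mul_rpow ENNReal.toReal_nonneg (by positivity), ← Real.rpow_mul ENNReal.toReal_nonneg,
      mul_one_div_cancel hq0.ne', Real.rpow_one] at h1
  refine hx2.trans ?_
  gcongr
  linarith

/-! ### Integrals in the extrapolation space -/

section Extrap

variable {q : ℝ≥0∞} [Fact (1 ≤ q)] {lam : ℕ → ℂ} {hlam : ∀ k, (lam k).re < 0}

namespace ExtrapSpace

variable (q hlam) in
/-- The coordinate functionals of `D(A*)'` are continuous. -/
noncomputable def coordCLM (k : ℕ) : ExtrapSpace q hlam →L[ℂ] ℂ :=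
  (1 - lam k) • (lp.evalCLM ℂ (fun _ : ℕ => ℂ) q k).comp
    (iso q hlam : ExtrapSpace q hlam →L[ℂ] Seq q)

lemma coordCLM_apply (k : ℕ) (c : ExtrapSpace q hlam) : coordCLM q hlam k c = c.coord k := by
  change (1 - lam k) * (c.coord k / (1 - lam k)) = c.coord k
  exact mul_div_cancel₀ _ (sub_ne hlam (z := 1) (by simp) k)

lemma norm_semigroupExt_le (t : ℝ≥0) (c : ExtrapSpace q hlam) :
    ‖semigroupExt q hlam t c‖ ≤ ‖c‖ := by
  rw [show semigroupExt q hlam t c = (iso q hlam).symm (semigroup q hlam t (iso q hlam c)) from rfl,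
    LinearIsometryEquiv.norm_map, ← (iso q hlam).norm_map c]
  refine lp.norm_mono (zero_lt_one.trans_le (Fact.out : 1 ≤ q)).ne' fun k => ?_
  change ‖Complex.exp (lam k * (t : ℝ)) * iso q hlam c k‖ ≤ _
  rw [norm_mul, Complex.norm_exp, Complex.re_mul_ofReal]
  exact mul_le_of_le_one_left (norm_nonneg _)
    (Real.exp_le_one_iff.2 (mul_nonpos_of_nonpos_of_nonneg (hlam k).le t.2))

lemma continuous_semigroupExt (hq : q ≠ ∞) (c : ExtrapSpace q hlam) :
    Continuous fun t : ℝ≥0 => semigroupExt q hlam t c := by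
  have h : Continuous fun t : ℝ≥0 => semigroup q hlam t (iso q hlam c) := by
    rw [continuous_iff_continuousAt]
    intro t₀
    set x := iso q hlam c
    have hexp : ∀ (t : ℝ≥0) k, ‖Complex.exp (lam k * (t : ℝ))‖ ≤ 1 := fun t k => by
      rw [Complex.norm_exp, Complex.re_mul_ofReal]
      exact Real.exp_le_one_iff.2 (mul_nonpos_of_nonpos_of_nonneg (hlam k).le t.2)
    refine tendsto_of_dominated hq (g := (2 : ℂ) • x) (fun k => ?_)
      (Eventually.of_forall fun t k => ?_)
    · have h : Continuous fun t : ℝ≥0 => Complex.exp (lam k * ((t : ℝ) : ℂ)) * x k := by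
        fun_prop
      exact h.tendsto t₀
    · change ‖Complex.exp (lam k * ((t : ℝ) : ℂ)) * x k -
        Complex.exp (lam k * ((t₀ : ℝ) : ℂ)) * x k‖ ≤ ‖2 * x k‖
      rw [← sub_mul, norm_mul, norm_mul, Complex.norm_ofNat]
      refine mul_le_mul_of_nonneg_right ?_ (norm_nonneg _)
      linarith [norm_sub_le (Complex.exp (lam k * ((t : ℝ) : ℂ)))
        (Complex.exp (lam k * ((t₀ : ℝ) : ℂ))), hexp t k, hexp t₀ k]
  exact (iso q hlam).symm.continuous.comp h

end ExtrapSpace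

lemma integrableOn_Ioc_of_memLp {p : ℝ≥0∞} (hp : 1 ≤ p) {u : ℝ → ℂ}
    (hu : MemLp u p (volume.restrict (Ioi 0))) (τ : ℝ) : IntegrableOn u (Ioc 0 τ) :=
  (hu.mono_measure (Measure.restrict_mono Ioc_subset_Ioi_self le_rfl)).integrable hp

/-- By linearity the integrand is `u(t)` times the orbit `T(t) B 1`, which is continuous and bounded
by `‖B 1‖`. -/
lemma integrableOn_semigroupExt (hq : q ≠ ∞) (B : ℂ →L[ℂ] ExtrapSpace q hlam) {u : ℝ → ℂ}
    {τ : ℝ} (hu : IntegrableOn u (Ioc 0 τ)) :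
    IntegrableOn (fun t : ℝ => ExtrapSpace.semigroupExt q hlam t.toNNReal (B (u t)))
      (Ioc 0 τ) := by
  have hB : ∀ t : ℝ, ExtrapSpace.semigroupExt q hlam t.toNNReal (B (u t)) =
      u t • ExtrapSpace.semigroupExt q hlam t.toNNReal (B 1) := fun t => by
    rw [← map_smul, ← map_smul, smul_eq_mul, mul_one]
  simp_rw [hB]
  have hc : Continuous fun t : ℝ => ExtrapSpace.semigroupExt q hlam t.toNNReal (B 1) :=
    (ExtrapSpace.continuous_semigroupExt hq (B 1)).comp continuous_real_toNNReal
  refine (hu.norm.mul_const ‖B 1‖).mono' (hu.1.smul hc.aestronglyMeasurable)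
    (Eventually.of_forall fun t => ?_)
  rw [norm_smul]
  exact mul_le_mul_of_nonneg_left (ExtrapSpace.norm_semigroupExt_le _ _) (norm_nonneg _)

/-- The link with the Laplace transform: continuous coordinate functionals commute with the Bochner
integral, leaving a truncated Laplace integral at `-λ_k`. -/
lemma coord_integral_semigroupExt (hq : q ≠ ∞) (B : ℂ →L[ℂ] ExtrapSpace q hlam) {u : ℝ → ℂ}
    {τ : ℝ} (hu : IntegrableOn u (Ioc 0 τ)) (k : ℕ) :
    (∫ t in Ioc 0 τ, ExtrapSpace.semigroupExt q hlam t.toNNReal (B (u t))).coord k =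
      (B 1).coord k * ∫ t in Ioc 0 τ, Complex.exp (-(-lam k * t)) * u t := by
  rw [← ExtrapSpace.coordCLM_apply, ← ContinuousLinearMap.integral_comp_comm _
    (integrableOn_semigroupExt hq B hu), ← integral_const_mul]
  refine setIntegral_congr_fun measurableSet_Ioc fun t ht => ?_
  have hB : B (u t) = u t • B 1 := by rw [← map_smul, smul_eq_mul, mul_one]
  simp only [hB, map_smul, ExtrapSpace.coordCLM_apply, ExtrapSpace.coord_semigroupExt,
    Real.coe_toNNReal _ ht.1.le, smul_eq_mul, neg_mul, neg_neg]
  ring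

lemma tendsto_eLpNorm_indicator_Ioi {p : ℝ≥0∞} (hp0 : p ≠ 0) (hp : p ≠ ∞) {u : ℝ → ℂ}
    {μ : Measure ℝ} (hu : MemLp u p μ) :
    Tendsto (fun τ : ℝ => eLpNorm ((Ioi τ).indicator u) p μ) atTop (𝓝 0) := by
  have hp' := ENNReal.toReal_pos hp0 hp
  have h : Tendsto (fun τ : ℝ => ∫⁻ t, ‖(Ioi τ).indicator u t‖ₑ ^ p.toReal ∂μ) atTop
      (𝓝 (∫⁻ _, 0 ∂μ)) := by
    refine tendsto_lintegral_filter_of_dominated_convergence' (fun t => ‖u t‖ₑ ^ p.toReal)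
      (Eventually.of_forall fun τ => ?_) (Eventually.of_forall fun τ => Eventually.of_forall
      fun t => ?_) (lintegral_rpow_enorm_lt_top_of_eLpNorm_lt_top hp0 hp hu.2).ne
      (Eventually.of_forall fun t => ?_)
    · exact (hu.1.indicator measurableSet_Ioi).enorm.pow_const _
    · gcongr
      exact enorm_indicator_le_enorm_self _ _
    · refine tendsto_const_nhds.congr' ?_
      filter_upwards [eventually_ge_atTop t] with τ hτ
      simp [indicator_of_notMem (show t ∉ Ioi τ from not_lt.2 hτ), hp']
  have h2 := ((ENNReal.continuous_rpow_const (y := 1 / p.toReal)).tendsto _).comp h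
  rw [lintegral_zero, ENNReal.zero_rpow_of_pos (by positivity)] at h2
  refine h2.congr fun τ => ?_
  rw [eLpNorm_eq_lintegral_rpow_enorm_toReal hp0 hp]
  rfl

/-- The Carleson condition implies admissibility. -/
lemma isAdmissible_of_carlesonSquare {p p' : ℝ≥0∞} (hq : q ≠ ∞) (hpp' : p.HolderConjugate p')
    (hp1 : 1 < p) (hp : p ≤ 2) (hp'0 : 0 < p'.toReal) (hp'q : p'.toReal ≤ q.toReal) {κ : ℝ}
    (B : ℂ →L[ℂ] ExtrapSpace q hlam)
    (h : ∀ I : Set ℝ, I.OrdConnected →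
      pointMeasure q lam (fun k => (B 1).coord k) (carlesonSquare I) ≤
      ENNReal.ofReal κ * volume I ^ (q.toReal / p'.toReal)) : IsAdmissible p q B := by
  obtain ⟨m, hm, hmap⟩ := exists_seq_laplace hpp' hp1 hp hp'0 hp'q hlam h
  refine ⟨m, hm, fun u => ?_⟩
  have hu : MemLp u p (volume.restrict (Ioi 0)) := Lp.memLp u
  obtain ⟨x, hx, hxn⟩ := hmap u hu
  have hp'top : p' ≠ ∞ := fun h => by simp [h] at hp'0
  have hptop : p ≠ ∞ := (hp.trans_lt (by simp)).ne
  have hIoc := integrableOn_Ioc_of_memLp hp1.le hu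
  -- `y τ` is the sequence attached to the tail of `u` beyond `τ`. The integral over `(0, τ]` is
  -- then `x - y τ`, and `y τ → 0` in `ℓ^q` because the tails vanish in `L^p`.
  choose y hy hyn using fun τ : ℝ => hmap ((Ioi τ).indicator u) (hu.indicator measurableSet_Ioi)
  refine ⟨x, ⟨fun τ => integrableOn_semigroupExt hq B (hIoc τ), ?_⟩, by rwa [Lp.norm_def]⟩
  have hint : ∀ τ : ℝ, 0 ≤ τ →
      ∫ t in Ioc 0 τ, ExtrapSpace.semigroupExt q hlam t.toNNReal (B (u t)) =
        ExtrapSpace.incl q hlam (x - y τ) := fun τ hτ => by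
    refine ExtrapSpace.ext_coord fun k => ?_
    rw [coord_integral_semigroupExt hq B (hIoc τ), ExtrapSpace.coord_incl]
    change _ = x k - y τ k
    rw [hx, hy, ← mul_sub]
    congr 1
    have hi := integrableOn_exp_neg_mul_of_memLp (z := -lam k) (by simpa using hlam k) hpp' hp'top hu
    have h2 : laplace ((Ioi τ).indicator u) (-lam k) =
        ∫ t in Ioi τ, Complex.exp (-(-lam k * t)) * u t := by
      rw [laplace]
      have e : ∀ t : ℝ, Complex.exp (-(-lam k * t)) * (Ioi τ).indicator u t =
          (Ioi τ).indicator (fun t : ℝ => Complex.exp (-(-lam k * t)) * u t) t := fun t => by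
        by_cases ht : t ∈ Ioi τ
        · rw [indicator_of_mem ht, indicator_of_mem ht]
        · rw [indicator_of_notMem ht, indicator_of_notMem ht, mul_zero]
      simp_rw [e]
      rw [setIntegral_indicator measurableSet_Ioi, inter_eq_right.2 (Ioi_subset_Ioi hτ)]
    have h3 := setIntegral_union (Ioc_disjoint_Ioi le_rfl) measurableSet_Ioi
      (hi.mono_set (Ioc_subset_Ioi_self : Ioc 0 τ ⊆ Ioi 0)) (hi.mono_set (Ioi_subset_Ioi hτ))
    rw [Ioc_union_Ioi_eq_Ioi hτ] at h3
    rw [h2, laplace, h3, add_sub_cancel_right]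
  have hy0 : Tendsto y atTop (𝓝 0) := by
    have h1 := (ENNReal.tendsto_toReal ENNReal.zero_ne_top).comp
      (tendsto_eLpNorm_indicator_Ioi (zero_lt_one.trans hp1).ne' hptop hu)
    have h2 := h1.const_mul m
    simp only [ENNReal.toReal_zero, mul_zero] at h2
    exact squeeze_zero_norm hyn h2
  have h3 := ((ExtrapSpace.incl q hlam).continuous.tendsto _).comp (hy0.const_sub x)
  rw [sub_zero] at h3
  refine h3.congr' ?_
  filter_upwards [eventually_ge_atTop 0] with τ hτ
  exact (hint τ hτ).symm

/-! ### Necessity of the Carleson condition -/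

/-- At `w = -λ_k` this is the `k`-th resolvent multiplier, which makes exponentials the right test
inputs. -/
lemma laplace_exp_neg_mul {z w : ℂ} (h : 0 < (w + z).re) :
    laplace (fun t : ℝ => Complex.exp (-(z * t))) w = (w + z)⁻¹ := by
  have e : ∀ t : ℝ, Complex.exp (-(w * t)) * Complex.exp (-(z * t)) =
      Complex.exp (-(w + z) * t) := fun t => by
    rw [← Complex.exp_add]; congr 1; ring
  rw [laplace]
  simp_rw [e]
  rw [integral_exp_mul_complex_Ioi (by rw [Complex.neg_re]; linarith), Complex.ofReal_zero,
    mul_zero, Complex.exp_zero, neg_div_neg_eq, one_div]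

/-- The norm equals `(p Re z)^{-1/p}`, and `p ≥ 1` lets the factor `p` be dropped. -/
lemma eLpNorm_exp_neg_mul_le {z : ℂ} (hz : 0 < z.re) {p : ℝ≥0∞} (hp1 : 1 ≤ p) (hp : p ≠ ∞) :
    (eLpNorm (fun t : ℝ => Complex.exp (-(z * t))) p (volume.restrict (Ioi 0))).toReal ≤
      |z.re| ^ (-(1 / p.toReal)) := by
  have hp0 : p ≠ 0 := (zero_lt_one.trans_le hp1).ne'
  have hp' := ENNReal.toReal_pos hp0 hp
  have hp1' : 1 ≤ p.toReal := by
    rw [← ENNReal.toReal_one]; exact ENNReal.toReal_mono hp hp1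
  have e : ∀ t : ℝ, ‖Complex.exp (-(z * t))‖ₑ ^ p.toReal =
      ENNReal.ofReal (Real.exp (-(z.re * p.toReal) * t)) := fun t => by
    rw [← ofReal_norm, ENNReal.ofReal_rpow_of_nonneg (norm_nonneg _) hp'.le, Complex.norm_exp,
      ← Real.exp_mul, Complex.neg_re, Complex.re_mul_ofReal]
    congr 2
    ring
  have hneg : -(z.re * p.toReal) < 0 := by nlinarith
  rw [eLpNorm_eq_lintegral_rpow_enorm_toReal hp0 hp]
  simp_rw [e]
  rw [← ofReal_integral_eq_lintegral_ofReal (integrableOn_exp_mul_Ioi hneg 0)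
    (Eventually.of_forall fun t => (Real.exp_pos _).le), integral_exp_mul_Ioi hneg, mul_zero,
    Real.exp_zero, neg_div_neg_eq, ← ENNReal.toReal_rpow, ENNReal.toReal_ofReal (by positivity),
    abs_of_pos hz, Real.rpow_neg hz.le, ← Real.inv_rpow hz.le]
  refine Real.rpow_le_rpow (by positivity) ?_ (by positivity)
  rw [one_div]
  exact inv_anti₀ hz (le_mul_of_one_le_right hz.le hp1')

/-- Admissibility implies the resolvent estimate. -/
lemma norm_resolventExt_comp_le_of_isAdmissible {p p' : ℝ≥0∞} (hq : q ≠ ∞)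
    (hpp' : p.HolderConjugate p') (hp1 : 1 < p) (hp : p ≠ ∞) (hp' : p' ≠ ∞)
    {B : ℂ →L[ℂ] ExtrapSpace q hlam} (h : IsAdmissible p q B) :
    ∃ κ : ℝ, 0 < κ ∧ ∀ (z : ℂ) (hz : 0 < z.re),
      ‖(ExtrapSpace.resolventExt q hlam z hz).comp B‖ ≤ κ * |z.re| ^ (-(1 / p.toReal)) := by
  obtain ⟨m, hm, hadm⟩ := h
  refine ⟨m, hm, fun z hz => ?_⟩
  have hmem := memLp_exp_neg_mul hz (zero_lt_one.trans hp1).ne' hp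
  set u : InputSpace p := hmem.toLp _ with hudef
  have hu : MemLp u p (volume.restrict (Ioi 0)) := Lp.memLp u
  obtain ⟨x, ⟨_, hlim⟩, hxn⟩ := hadm u
  -- Convergence in `D(A*)'` implies convergence of coordinates, so uniqueness of limits identifies
  -- the output for the input `e^{-zt}` as `(z - A)⁻¹ B 1`.
  have hx : x = ExtrapSpace.resolventExt q hlam z hz (B 1) := by
    ext k
    have hk : 0 < (-lam k).re := by simpa using hlam k
    have hi := integrableOn_exp_neg_mul_of_memLp hk hpp' hp' hu
    have h1 := ((ExtrapSpace.coordCLM q hlam k).continuous.tendsto _).comp hlim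
    have h2 : Tendsto (fun τ : ℝ => (B 1).coord k *
        ∫ t in Ioc 0 τ, Complex.exp (-(-lam k * t)) * u t) atTop
        (𝓝 ((B 1).coord k * laplace u (-lam k))) := by
      refine Tendsto.const_mul _ ?_
      refine (intervalIntegral_tendsto_integral_Ioi 0 hi tendsto_id).congr' ?_
      filter_upwards [eventually_ge_atTop 0] with τ hτ
      exact intervalIntegral.integral_of_le hτ
    have h3 : x k = (B 1).coord k * laplace u (-lam k) := by
      rw [← ExtrapSpace.coord_incl (hlam := hlam), ← ExtrapSpace.coordCLM_apply]
      refine tendsto_nhds_unique h1 (h2.congr fun τ => ?_)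
      rw [Function.comp_apply, ExtrapSpace.coordCLM_apply,
        coord_integral_semigroupExt hq B (integrableOn_Ioc_of_memLp hp1.le hu τ)]
    rw [h3, laplace_congr_ae hmem.coeFn_toLp, laplace_exp_neg_mul (by simp at hk ⊢; linarith),
      ExtrapSpace.resolventExt_apply, div_eq_mul_inv, neg_add_eq_sub]
  have hun : ‖u‖ ≤ |z.re| ^ (-(1 / p.toReal)) := by
    rw [hudef, Lp.norm_toLp]
    exact eLpNorm_exp_neg_mul_le hz hp1.le hp
  refine ContinuousLinearMap.opNorm_le_bound _ (by positivity) fun c => ?_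
  have hc : (ExtrapSpace.resolventExt q hlam z hz).comp B c = c • x := by
    rw [hx, ← map_smul, ← map_smul, smul_eq_mul, mul_one]
    rfl
  rw [hc, norm_smul, mul_comm]
  gcongr
  exact hxn.trans (by gcongr)

/-- The resolvent estimate implies the Carleson condition. -/
lemma carlesonSquare_le_of_norm_resolventExt_comp_le {p p' : ℝ≥0∞} (hq : q ≠ ∞)
    (hconj : p.toReal.HolderConjugate p'.toReal) {B : ℂ →L[ℂ] ExtrapSpace q hlam} {κ : ℝ}
    (hκ : 0 < κ) (h : ∀ (z : ℂ) (hz : 0 < z.re),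
      ‖(ExtrapSpace.resolventExt q hlam z hz).comp B‖ ≤ κ * |z.re| ^ (-(1 / p.toReal)))
    (I : Set ℝ) (hI : I.OrdConnected) :
    pointMeasure q lam (fun k => (B 1).coord k) (carlesonSquare I) ≤
      ENNReal.ofReal ((3 * κ) ^ q.toReal) * volume I ^ (q.toReal / p'.toReal) := by
  have hq0 : 0 < q.toReal :=
    ENNReal.toReal_pos (zero_lt_one.trans_le (Fact.out : 1 ≤ q)).ne' hq
  have hp'0 := hconj.symm.pos
  rcases eq_or_ne (volume I) 0 with hI0 | hI0
  · have : carlesonSquare I = ∅ := by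
      ext z
      simp [carlesonSquare, hI0]
    simp [this]
  -- For an unbounded interval the right-hand side is infinite, as both its constant and its
  -- exponent are positive.
  rcases eq_or_ne (volume I) ∞ with hItop | hItop
  · have : 0 < ENNReal.ofReal ((3 * κ) ^ q.toReal) := ENNReal.ofReal_pos.2 (by positivity)
    rw [hItop, ENNReal.top_rpow_of_pos (by positivity), ENNReal.mul_top this.ne']
    exact le_top
  set r := (volume I).toReal
  have hr : 0 < r := ENNReal.toReal_pos hI0 hItop
  have hvol : volume I = ENNReal.ofReal r := (ENNReal.ofReal_toReal hItop).symm
  obtain ⟨y₀, hy₀⟩ : I.Nonempty := nonempty_of_measure_ne_zero hI0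
  have hdist : ∀ y ∈ I, |y - y₀| ≤ r := fun y hy => by
    have h1 := measure_mono (μ := volume) (hI.uIcc_subset hy₀ hy)
    rw [Real.volume_interval, hvol] at h1
    exact (ENNReal.ofReal_le_ofReal_iff hr.le).1 h1
  -- The sign makes `Im (z - λ_k) = Im (-λ_k) - y₀`. In the square this is at most `r` in absolute
  -- value while the real part is below `2r`, hence the constant `3`. Any point `y₀` of the interval
  -- serves.
  set z : ℂ := ⟨r, -y₀⟩
  have hz : 0 < z.re := hr
  set x := ExtrapSpace.resolventExt q hlam z hz (B 1) with hxdef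
  have hx : ‖x‖ ≤ κ * r ^ (-(1 / p.toReal)) := by
    have h1 := ((ExtrapSpace.resolventExt q hlam z hz).comp B).le_opNorm 1
    rw [norm_one, mul_one] at h1
    refine h1.trans ((h z hz).trans_eq ?_)
    rw [abs_of_pos hz]
  have hb : ∀ k, -lam k ∈ carlesonSquare I → ‖(B 1).coord k‖ ≤ 3 * r * ‖x k‖ := by
    rintro k ⟨h1, h2, h3⟩
    rw [hvol, ENNReal.ofReal_lt_ofReal_iff hr] at h3
    have h4 : ‖z - lam k‖ ≤ 3 * r := by
      refine (Complex.norm_le_abs_re_add_abs_im _).trans ?_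
      have h5 := hdist _ h1
      have h6 : (z - lam k).im = (-lam k).im - y₀ := by simp [z]; ring
      have h7 : (z - lam k).re = r + (-lam k).re := by simp [z]; ring
      rw [h6, h7, abs_of_pos (by linarith)]
      linarith
    have h8 := sub_ne hlam hz k
    have h9 : (B 1).coord k = (z - lam k) * x k := by
      rw [hxdef, ExtrapSpace.resolventExt_apply, mul_div_cancel₀ _ h8]
    rw [h9, norm_mul]
    gcongr
  have hsummable : Summable fun k => ‖x k‖ ^ q.toReal := (lp.memℓp x).summable hq0
  calc pointMeasure q lam (fun k => (B 1).coord k) (carlesonSquare I)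
      ≤ ∑' k, ENNReal.ofReal ((3 * r) ^ q.toReal) * ENNReal.ofReal (‖x k‖ ^ q.toReal) := by
        rw [pointMeasure_apply]
        refine ENNReal.tsum_le_tsum fun k => ?_
        by_cases hk : -lam k ∈ carlesonSquare I
        · rw [indicator_of_mem hk, Pi.one_apply, mul_one, ← ENNReal.ofReal_mul (by positivity),
            ← Real.mul_rpow (by positivity) (norm_nonneg _)]
          exact ENNReal.ofReal_le_ofReal (Real.rpow_le_rpow (norm_nonneg _) (hb k hk) hq0.le)
        · rw [indicator_of_notMem hk, mul_zero]
          exact bot_le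
    _ = ENNReal.ofReal ((3 * r * ‖x‖) ^ q.toReal) := by
        rw [ENNReal.tsum_mul_left, ← ENNReal.ofReal_tsum_of_nonneg (fun k => by positivity)
          hsummable, ← lp.norm_rpow_eq_tsum hq0, ← ENNReal.ofReal_mul (by positivity),
          ← Real.mul_rpow (by positivity) (norm_nonneg _)]
    _ ≤ ENNReal.ofReal ((3 * r * (κ * r ^ (-(1 / p.toReal)))) ^ q.toReal) := by gcongr
    _ = _ := by
        rw [hvol, ENNReal.ofReal_rpow_of_nonneg hr.le (by positivity),
          ← ENNReal.ofReal_mul (by positivity)]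
        congr 1
        -- Conjugacy, `1 - 1/p = 1/p'`, converts the resolvent decay into the Carleson exponent.
        have e1 : r * r ^ (-(1 / p.toReal)) = r ^ (1 / p'.toReal) := by
          rw [← Real.rpow_one_add' hr.le]
          · congr 1
            have := hconj.inv_add_inv_eq_one
            simp only [one_div]
            linarith
          · have := hconj.inv_add_inv_eq_one
            have h2 := inv_pos.2 hp'0
            simp only [one_div]
            linarith
        rw [show 3 * r * (κ * r ^ (-(1 / p.toReal))) = 3 * κ * (r * r ^ (-(1 / p.toReal))) by ring,
          e1, Real.mul_rpow (by positivity) (by positivity), ← Real.rpow_mul hr.le,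
          one_div_mul_eq_div]

end Extrap

end DiagSys

/-! ### Equivalence of the three conditions -/

theorem mainTheorem9 (p p' q : ℝ≥0∞) [Fact (1 ≤ q)] (hpp' : ENNReal.HolderConjugate p p')
    (hp : p ≤ 2) (hp' : 1 < p') (hp'q : p' ≤ q) (hq : q < ∞)
    (lam : ℕ → ℂ) (hlam : ∀ k, (lam k).re < 0)
    (B : ℂ →L[ℂ] DiagSys.ExtrapSpace q hlam) (b : ℕ → ℂ) (hb : ∀ k, (B 1).coord k = b k) :
    List.TFAE [
      DiagSys.IsAdmissible p q B,
      ∃ κ : ℝ, 0 < κ ∧ ∀ I : Set ℝ, I.OrdConnected →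
        DiagSys.pointMeasure q lam b (DiagSys.carlesonSquare I)
          ≤ ENNReal.ofReal κ * volume I ^ (q.toReal / p'.toReal),
      ∃ κ : ℝ, 0 < κ ∧ ∀ (z : ℂ) (hz : 0 < z.re),
        ‖(DiagSys.ExtrapSpace.resolventExt q hlam z hz).comp B‖
          ≤ κ * |z.re| ^ (-(1 / p.toReal))] := by
  obtain rfl : (fun k => (B 1).coord k) = b := funext hb
  have hp'top : p' ≠ ∞ := (hp'q.trans_lt hq).ne
  have hptop : p ≠ ∞ := (hp.trans_lt (by simp)).ne
  have hconj : p.toReal.HolderConjugate p'.toReal :=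
    ENNReal.HolderConjugate.toReal_of_ne_top hptop hp'top
  have hp1 : 1 < p := by
    rw [← ENNReal.toReal_lt_toReal ENNReal.one_ne_top hptop, ENNReal.toReal_one]
    exact hconj.lt
  tfae_have 1 → 3 := fun h =>
    DiagSys.norm_resolventExt_comp_le_of_isAdmissible hq.ne hpp' hp1 hptop hp'top h
  tfae_have 3 → 2 := fun ⟨κ, hκ, h⟩ => ⟨(3 * κ) ^ q.toReal, by positivity,
    DiagSys.carlesonSquare_le_of_norm_resolventExt_comp_le hq.ne hconj hκ h⟩
  tfae_have 2 → 1 := fun ⟨κ, _, h⟩ => DiagSys.isAdmissible_of_carlesonSquare hq.ne hpp' hp1 hp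
    hconj.symm.pos (ENNReal.toReal_mono hq.ne hp'q) B h
  tfae_finish
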